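/- A pinned graph $\hat G=(I,P;E)$ is a finite simple graph with vertex set $I\sqcup P$ ($I$ inner, $P$ pinned vertices); subgraphs keep inner vertices inner and pinned vertices pinned. For $\mathbf p:I\cup P\to\mathbb R^d$ the pinned rigidity matrix has one row per edge and $d$ columns per inner vertex, the row of $vw$ having the entries $\mathbf p_v-\mathbf p_w$ at $v$ if $v\in I$, $\mathbf p_w-\mathbf p_v$ at $w$ if $w\in I$, and $0$ elsewhere. $\hat G$ is pinned isostatic at $\mathbf p$ if this matrix has independent rows and trivial kernel, and pinned $d$-isostatic if this holds for some $\mathbf p$. Let a group $\mathcal S$ act on $\hat G$ by automorphisms preserving $I$ and $P$, and let $\tau:\mathcal S\to O(\mathbb R^d)$ be a homomorphism. A realisation is $\mathcal S$-symmetric if $\mathbf p_{xv}=\tau(x)\mathbf p_v$ for all $x\in\mathcal S$ and all vertices $v$. Let $\hat H$ be the quotient $\mathcal S$-gain graph: its vertices and edges are the orbits; after choosing a representative of each vertex orbit, an edge orbit $\{\{xu,xgv\}:x\in\mathcal S\}$ ($u,v$ representatives) is an edge from $\tilde u$ to $\tilde v$ with gain $g$. For $\tilde{\mathbf p}:\hat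 I\cup\hat P\to\mathbb R^d$ the pinned orbit matrix has one row per edge and $d$ columns per inner vertex of $\hat H$; the row of such an edge has the entries $\tilde{\mathbf p}_{\tilde u}-\tau(g)\tilde{\mathbf p}_{\tilde v}$ at $\tilde u$ and $\tilde{\mathbf p}_{\tilde v}-\tau(g)^{-1}\tilde{\mathbf p}_{\tilde u}$ at $\tilde v$ (where these are inner), the two being added for a loop. A pinned gain graph is pinned $\mathcal S$-isostatic if for some $\tilde{\mathbf p}$ this matrix has independent rows and trivial kernel; $\hat G$ is pinned $\mathcal S$-isostatic if this holds for $\hat H$ with the positions of the representatives in some $\mathcal S$-symmetric realisation of $\hat G$. An $\mathcal S$-symmetric realisation is pinned $\mathcal S$-regular if its orbit matrix has maximal rank among all $\mathcal S$-symmetric realisations of $\hat G$. A $d$-Assur (resp. $\mathcal S$-Assur) graph is a pinned $d$-isostatic graph (resp. pinned $\mathcal S$-isostatic gain graph) with at least one inner vertex, no proper subgraph of which that contains an inner vertex is again pinned $d$-isostatic (resp. pinned $\mathcal S$-isostatic). The $d$-Assur decomposition of $\hat G$ is obtained by choosing a $d$-Assur subgraph, collapsing it into the ground (its inner vertices become pinned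 vertices, and edges without an inner end are dropped), choosing a $d$-Assur subgraph of the resulting pinned graph, and so on; the $d$-Assur graphs of $\hat G$ are all those that can be chosen at some stage. The $\mathcal S$-Assur graphs of $\hat H$ are defined in the same way. **Theorem.** Suppose that $\hat G$ is pinned $\mathcal S$-isostatic and is pinned isostatic at every pinned $\mathcal S$-regular realisation, and that the action of $\mathcal S$ is free on the vertices and on the edges of $\hat G$. Then the projection to $\hat H$ of each $d$-Assur graph of the decomposition of $\hat G$ is an $\mathcal S$-Assur graph of the decomposition of $\hat H$; and the lift to $\hat G$ (the preimage under the covering map) of each $\mathcal S$-Assur graph of the decomposition of $\hat H$ is the union of a family (possibly with only one member) of $d$-Assur graphs of the decomposition of $\hat G$ whose sets of inner vertices are pairwise disjoint. -/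

import Mathlib

/-! ### Pinned graphs, pinned frameworks and the `d`-Assur decomposition -/

/-- A finite simple pinned graph `(I, P; E)`, whose vertices are taken from an ambient type `V`. -/
structure PinnedGraph (V : Type*) where
  /-- the inner vertices -/
  inner : Finset V
  /-- the pinned vertices -/
  pinned : Finset V
  /-- the edges, as unordered pairs of vertices -/
  edges : Finset (Sym2 V)
  disjoint : Disjoint inner pinned
  loopless : ∀ e ∈ edges, ¬ e.IsDiag
  mem_or_mem : ∀ e ∈ edges, ∀ v ∈ e, v ∈ inner ∨ v ∈ pinned

namespace PinnedGraph

variable {V : Type*}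

/-- `K` is a subgraph of `G`: inner vertices stay inner and pinned vertices stay pinned. -/
def IsSubgraph (K G : PinnedGraph V) : Prop :=
  K.inner ⊆ G.inner ∧ K.pinned ⊆ G.pinned ∧ K.edges ⊆ G.edges

open Classical in
/-- The pinned rigidity matrix of the framework `(G, p)`: one row per edge, `d` columns per inner
vertex; the row of an edge `vw` has the entries `p v - p w` at `v` (if `v` is inner). -/
noncomputable def rigidityMatrix (G : PinnedGraph V) {d : ℕ} (p : V → EuclideanSpace ℝ (Fin d)) :
    Matrix G.edges (G.inner × Fin d) ℝ :=
  fun e c => if h : c.1.1 ∈ e.1 then (p c.1.1 - p (Sym2.Mem.other h)) c.2 else 0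

/-- The framework `(G, p)` is pinned infinitesimally rigid. -/
def IsRigidAt (G : PinnedGraph V) {d : ℕ} (p : V → EuclideanSpace ℝ (Fin d)) : Prop :=
  ∀ U : G.inner × Fin d → ℝ, (G.rigidityMatrix p).mulVec U = 0 → U = 0

/-- The framework `(G, p)` is pinned `d`-independent. -/
def IsIndependentAt (G : PinnedGraph V) {d : ℕ} (p : V → EuclideanSpace ℝ (Fin d)) : Prop :=
  LinearIndependent ℝ (G.rigidityMatrix p).row

/-- The framework `(G, p)` is pinned `d`-isostatic. -/
def IsIsostaticAt (G : PinnedGraph V) {d : ℕ} (p : V → EuclideanSpace ℝ (Fin d)) : Prop :=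
  G.IsRigidAt p ∧ G.IsIndependentAt p

/-- The pinned graph `G` is pinned `d`-isostatic: it has a pinned `d`-isostatic realisation. -/
def IsIsostatic (d : ℕ) (G : PinnedGraph V) : Prop :=
  ∃ p : V → EuclideanSpace ℝ (Fin d), G.IsIsostaticAt p

/-- `K` is a `d`-Assur graph: it is minimal among the pinned `d`-isostatic graphs that contain at
least one inner vertex. -/
def IsAssur (d : ℕ) (K : PinnedGraph V) : Prop :=
  K.inner.Nonempty ∧ K.IsIsostatic d ∧
    ∀ K' : PinnedGraph V, K'.IsSubgraph K → K'.inner.Nonempty → K'.IsIsostatic d → K' = K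

open Classical in
/-- Collapse the inner vertices in `A` into the ground: they become pinned vertices, and only the
edges that still have an inner vertex are kept. -/
noncomputable def ground (G : PinnedGraph V) (A : Finset V) : PinnedGraph V where
  inner := G.inner \ A
  pinned := G.pinned ∪ A
  edges := G.edges.filter fun e => ∃ v ∈ e, v ∈ G.inner ∧ v ∉ A
  disjoint := by
    rw [Finset.disjoint_left]
    intro v hv hv'
    rw [Finset.mem_sdiff] at hv
    rcases Finset.mem_union.1 hv' with h | h
    · exact Finset.disjoint_left.1 G.disjoint hv.1 h
    · exact hv.2 h
  loopless := fun e he => G.loopless e (Finset.mem_filter.1 he).1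
  mem_or_mem := by
    intro e he v hv
    have := G.mem_or_mem e (Finset.mem_filter.1 he).1 v hv
    simp only [Finset.mem_sdiff, Finset.mem_union]
    tauto

/-- `K` is a component of the `d`-Assur decomposition of `G`. The decomposition takes a `d`-Assur
subgraph, collapses it into the ground, takes a `d`-Assur subgraph of the resulting pinned graph,
and so on; the components are the `d`-Assur graphs that occur. -/
inductive IsAssurComponent (d : ℕ) : PinnedGraph V → PinnedGraph V → Prop
  | bottom {G K : PinnedGraph V} : K.IsSubgraph G → K.IsAssur d → IsAssurComponent d G K
  | above {G A K : PinnedGraph V} : A.IsSubgraph G → A.IsAssur d →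
      IsAssurComponent d (G.ground A.inner) K → IsAssurComponent d G K

/-- The group `S`, acting on the ambient vertex type, acts on `G` by automorphisms that map inner
vertices to inner vertices and pinned vertices to pinned vertices. -/
def IsSymmetric (S : Type*) [Group S] [MulAction S V] (G : PinnedGraph V) : Prop :=
  (∀ (x : S), ∀ v ∈ G.inner, x • v ∈ G.inner) ∧
  (∀ (x : S), ∀ v ∈ G.pinned, x • v ∈ G.pinned) ∧
  (∀ (x : S), ∀ e ∈ G.edges, Sym2.map (x • ·) e ∈ G.edges)

/-- The action of `S` is free on the vertices of `G`. -/
def IsFreeOnVertices (S : Type*) [Group S] [MulAction S V] (G : PinnedGraph V) : Prop :=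
  ∀ v, v ∈ G.inner ∨ v ∈ G.pinned → ∀ x : S, x • v = v → x = 1

/-- The action of `S` is free on the edges of `G`. -/
def IsFreeOnEdges (S : Type*) [Group S] [MulAction S V] (G : PinnedGraph V) : Prop :=
  ∀ e ∈ G.edges, ∀ x : S, Sym2.map (x • ·) e = e → x = 1

/-- The framework `(G, p)` is `S`-symmetric, where `S` acts on `ℝᵈ` by `τ`. -/
def IsSymmetricAt {S : Type*} [Group S] [MulAction S V] {d : ℕ}
    (τ : S →* (EuclideanSpace ℝ (Fin d) ≃ₗᵢ[ℝ] EuclideanSpace ℝ (Fin d)))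
    (G : PinnedGraph V) (p : V → EuclideanSpace ℝ (Fin d)) : Prop :=
  ∀ (x : S) (v : V), v ∈ G.inner ∨ v ∈ G.pinned → p (x • v) = τ x (p v)

end PinnedGraph

/-! ### Pinned gain graphs, the pinned orbit matrix and the `S`-Assur decomposition -/

/-- A directed multigraph with vertices `W` and edges `F` (loops allowed), with a label in `S` on
each edge. The direction is only a reference orientation. -/
structure GainGraph (S W F : Type*) where
  /-- the start vertex of an edge -/
  src : F → W
  /-- the end vertex of an edge -/
  tgt : F → W
  /-- the gain of an edge -/
  gain : F → S

/-- A finite pinned gain graph `(I, P; E)`, with incidences and gains taken from `Γ`. -/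
structure PinnedGainGraph {S W F : Type*} (Γ : GainGraph S W F) where
  /-- the inner vertices -/
  inner : Finset W
  /-- the pinned vertices -/
  pinned : Finset W
  /-- the edges -/
  edges : Finset F
  disjoint : Disjoint inner pinned
  src_mem : ∀ f ∈ edges, Γ.src f ∈ inner ∨ Γ.src f ∈ pinned
  tgt_mem : ∀ f ∈ edges, Γ.tgt f ∈ inner ∨ Γ.tgt f ∈ pinned

namespace PinnedGainGraph

variable {S W F : Type*} {Γ : GainGraph S W F}

/-- `L` is a subgraph of `H`: inner vertices stay inner and pinned vertices stay pinned. -/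
def IsSubgraph (L H : PinnedGainGraph Γ) : Prop :=
  L.inner ⊆ H.inner ∧ L.pinned ⊆ H.pinned ∧ L.edges ⊆ H.edges

open Classical in
/-- The pinned orbit matrix: one row per edge, `d` columns per inner vertex. The row of an edge from
`u` to `v` with gain `g` has the entries `q u - τ g (q v)` at `u` and `q v - (τ g)⁻¹ (q u)` at `v`
(as far as these are inner); for a loop at `u` the two are added up, which gives
`2 q u - τ g (q u) - (τ g)⁻¹ (q u)`. -/
noncomputable def orbitMatrix [Group S] {d : ℕ}
    (τ : S →* (EuclideanSpace ℝ (Fin d) ≃ₗᵢ[ℝ] EuclideanSpace ℝ (Fin d)))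
    (H : PinnedGainGraph Γ) (q : W → EuclideanSpace ℝ (Fin d)) :
    Matrix H.edges (H.inner × Fin d) ℝ :=
  fun f c =>
    (if c.1.1 = Γ.src f then
      (q (Γ.src f) - τ (Γ.gain f) (q (Γ.tgt f))) c.2 else 0) +
    (if c.1.1 = Γ.tgt f then
      (q (Γ.tgt f) - τ (Γ.gain f)⁻¹ (q (Γ.src f))) c.2 else 0)

/-- Pinned `S`-symmetric infinitesimal rigidity of the realisation `q`. -/
def IsRigidAt [Group S] {d : ℕ}
    (τ : S →* (EuclideanSpace ℝ (Fin d) ≃ₗᵢ[ℝ] EuclideanSpace ℝ (Fin d)))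
    (H : PinnedGainGraph Γ) (q : W → EuclideanSpace ℝ (Fin d)) : Prop :=
  ∀ U : H.inner × Fin d → ℝ, (H.orbitMatrix τ q).mulVec U = 0 → U = 0

/-- Pinned `S`-independence of the realisation `q`. -/
def IsIndependentAt [Group S] {d : ℕ}
    (τ : S →* (EuclideanSpace ℝ (Fin d) ≃ₗᵢ[ℝ] EuclideanSpace ℝ (Fin d)))
    (H : PinnedGainGraph Γ) (q : W → EuclideanSpace ℝ (Fin d)) : Prop :=
  LinearIndependent ℝ (H.orbitMatrix τ q).row

/-- The realisation `q` is pinned `S`-isostatic. -/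
def IsIsostaticAt [Group S] {d : ℕ}
    (τ : S →* (EuclideanSpace ℝ (Fin d) ≃ₗᵢ[ℝ] EuclideanSpace ℝ (Fin d)))
    (H : PinnedGainGraph Γ) (q : W → EuclideanSpace ℝ (Fin d)) : Prop :=
  H.IsRigidAt τ q ∧ H.IsIndependentAt τ q

/-- The pinned gain graph `H` is pinned `S`-isostatic: it has a pinned `S`-isostatic realisation. -/
def IsIsostatic [Group S] {d : ℕ}
    (τ : S →* (EuclideanSpace ℝ (Fin d) ≃ₗᵢ[ℝ] EuclideanSpace ℝ (Fin d)))
    (H : PinnedGainGraph Γ) : Prop :=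
  ∃ q : W → EuclideanSpace ℝ (Fin d), H.IsIsostaticAt τ q

/-- `L` is an `S`-Assur graph: it is minimal among the pinned `S`-isostatic graphs that contain at
least one inner vertex. -/
def IsAssur [Group S] {d : ℕ}
    (τ : S →* (EuclideanSpace ℝ (Fin d) ≃ₗᵢ[ℝ] EuclideanSpace ℝ (Fin d)))
    (L : PinnedGainGraph Γ) : Prop :=
  L.inner.Nonempty ∧ L.IsIsostatic τ ∧
    ∀ L' : PinnedGainGraph Γ, L'.IsSubgraph L → L'.inner.Nonempty → L'.IsIsostatic τ → L' = L

open Classical in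
/-- Collapse the inner vertices in `A` into the ground: they become pinned vertices, and only the
edges that still have an inner vertex are kept. -/
noncomputable def ground (H : PinnedGainGraph Γ) (A : Finset W) : PinnedGainGraph Γ where
  inner := H.inner \ A
  pinned := H.pinned ∪ A
  edges := H.edges.filter fun f =>
    (Γ.src f ∈ H.inner ∧ Γ.src f ∉ A) ∨ (Γ.tgt f ∈ H.inner ∧ Γ.tgt f ∉ A)
  disjoint := by
    rw [Finset.disjoint_left]
    intro v hv hv'
    rw [Finset.mem_sdiff] at hv
    rcases Finset.mem_union.1 hv' with h | h
    · exact Finset.disjoint_left.1 H.disjoint hv.1 h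
    · exact hv.2 h
  src_mem := by
    intro f hf
    have := H.src_mem f (Finset.mem_filter.1 hf).1
    simp only [Finset.mem_sdiff, Finset.mem_union]
    tauto
  tgt_mem := by
    intro f hf
    have := H.tgt_mem f (Finset.mem_filter.1 hf).1
    simp only [Finset.mem_sdiff, Finset.mem_union]
    tauto

/-- `L` is a component of the `S`-Assur decomposition of `H`. The decomposition takes an `S`-Assur
subgraph, collapses it into the ground, takes an `S`-Assur subgraph of the resulting pinned gain
graph, and so on; the components are the `S`-Assur graphs that occur. -/
inductive IsAssurComponent [Group S] {d : ℕ}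
    (τ : S →* (EuclideanSpace ℝ (Fin d) ≃ₗᵢ[ℝ] EuclideanSpace ℝ (Fin d))) :
    PinnedGainGraph Γ → PinnedGainGraph Γ → Prop
  | bottom {H L : PinnedGainGraph Γ} : L.IsSubgraph H → L.IsAssur τ → IsAssurComponent τ H L
  | above {H A L : PinnedGainGraph Γ} : A.IsSubgraph H → A.IsAssur τ →
      IsAssurComponent τ (H.ground A.inner) L → IsAssurComponent τ H L

end PinnedGainGraph

/-! ### The quotient gain graph, projections and lifts -/

/-- Two unordered pairs are equivalent if a group element maps one to the other. -/
def edgeOrbitSetoid (S V : Type*) [Group S] [MulAction S V] : Setoid (Sym2 V) where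
  r e e' := ∃ x : S, Sym2.map (x • ·) e = e'
  iseqv :=
    { refl := fun e => ⟨1, by simp⟩
      symm := by
        rintro e _ ⟨x, rfl⟩
        exact ⟨x⁻¹, by simp [Sym2.map_map]⟩
      trans := by
        rintro e _ _ ⟨x, rfl⟩ ⟨y, rfl⟩
        exact ⟨y * x, by simp [Sym2.map_map, mul_smul]⟩ }

/-- The vertex orbits. -/
abbrev VertexOrbits (S V : Type*) [Group S] [MulAction S V] : Type _ :=
  MulAction.orbitRel.Quotient S V

/-- The edge orbits (of all unordered pairs of vertices). -/
abbrev EdgeOrbits (S V : Type*) [Group S] [MulAction S V] : Type _ :=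
  Quotient (edgeOrbitSetoid S V)

/-- The covering map on vertices. -/
def vertexOrbit (S : Type*) {V : Type*} [Group S] [MulAction S V] (v : V) : VertexOrbits S V :=
  Quotient.mk (MulAction.orbitRel S V) v

/-- The covering map on edges. -/
def edgeOrbit (S : Type*) {V : Type*} [Group S] [MulAction S V] (e : Sym2 V) : EdgeOrbits S V :=
  Quotient.mk (edgeOrbitSetoid S V) e

/-- The choices that define a quotient gain graph: a representative of each vertex orbit, and for
each edge orbit a direction and a gain `g` such that it is the orbit of the edge that joins the
representative of its start to `g` times the representative of its end. -/
structure QuotientLabelling (S V : Type*) [Group S] [MulAction S V] extends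
    GainGraph S (VertexOrbits S V) (EdgeOrbits S V) where
  /-- the representative of a vertex orbit -/
  rep : VertexOrbits S V → V
  vertexOrbit_rep : ∀ o, vertexOrbit S (rep o) = o
  edgeOrbit_rep : ∀ f, edgeOrbit S s(rep (src f), gain f • rep (tgt f)) = f

namespace PinnedGraph

variable {S V : Type*} [Group S] [MulAction S V]

/-- Each end of a representative of an edge orbit lies over an end of any edge in it. -/
theorem exists_mem_of_edgeOrbit_eq {e e' : Sym2 V} (h : edgeOrbit S e = edgeOrbit S e') {v : V}
    (hv : v ∈ e') : ∃ w ∈ e, vertexOrbit S w = vertexOrbit S v := by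
  obtain ⟨x, rfl⟩ := Quotient.exact h
  obtain ⟨w, hw, rfl⟩ := Sym2.mem_map.1 hv
  exact ⟨w, hw, (Quotient.sound ⟨x, rfl⟩ : vertexOrbit S (x • w) = vertexOrbit S w).symm⟩

theorem vertexOrbit_smul (x : S) (v : V) : vertexOrbit S (x • v) = vertexOrbit S v :=
  Quotient.sound ⟨x, rfl⟩

open Classical in
/-- The quotient `S`-gain graph of an `S`-symmetric pinned graph. -/
noncomputable def quotient (G : PinnedGraph V) (hG : G.IsSymmetric S)
    (c : QuotientLabelling S V) : PinnedGainGraph c.toGainGraph where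
  inner := G.inner.image (vertexOrbit S)
  pinned := G.pinned.image (vertexOrbit S)
  edges := G.edges.image (edgeOrbit S)
  disjoint := by
    rw [Finset.disjoint_left]
    intro o ho ho'
    obtain ⟨v, hv, rfl⟩ := Finset.mem_image.1 ho
    obtain ⟨w, hw, hvw⟩ := Finset.mem_image.1 ho'
    obtain ⟨x, rfl⟩ := Quotient.exact hvw
    exact Finset.disjoint_left.1 G.disjoint (hG.1 x v hv) hw
  src_mem := by
    intro f hf
    obtain ⟨e, he, hef⟩ := Finset.mem_image.1 hf
    obtain ⟨w, hw, hwv⟩ := exists_mem_of_edgeOrbit_eq (hef.trans (c.edgeOrbit_rep f).symm)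
      (Sym2.mem_mk_left _ _)
    rw [c.vertexOrbit_rep] at hwv
    rw [← hwv]
    exact (G.mem_or_mem e he w hw).imp (Finset.mem_image_of_mem _) (Finset.mem_image_of_mem _)
  tgt_mem := by
    intro f hf
    obtain ⟨e, he, hef⟩ := Finset.mem_image.1 hf
    obtain ⟨w, hw, hwv⟩ := exists_mem_of_edgeOrbit_eq (hef.trans (c.edgeOrbit_rep f).symm)
      (Sym2.mem_mk_right _ _)
    rw [vertexOrbit_smul, c.vertexOrbit_rep] at hwv
    rw [← hwv]
    exact (G.mem_or_mem e he w hw).imp (Finset.mem_image_of_mem _) (Finset.mem_image_of_mem _)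

/-- The pinned orbit matrix of an `S`-symmetric framework `(G, p)`: the one of the quotient gain
graph, realised by the positions of the representatives. -/
noncomputable def orbitMatrix {d : ℕ}
    (τ : S →* (EuclideanSpace ℝ (Fin d) ≃ₗᵢ[ℝ] EuclideanSpace ℝ (Fin d)))
    (G : PinnedGraph V) (hG : G.IsSymmetric S) (c : QuotientLabelling S V)
    (p : V → EuclideanSpace ℝ (Fin d)) :
    Matrix (G.quotient hG c).edges ((G.quotient hG c).inner × Fin d) ℝ :=
  (G.quotient hG c).orbitMatrix τ fun o => p (c.rep o)

/-- `G` is pinned `S`-isostatic: it has an `S`-symmetric realisation that is pinned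
`S`-isostatic. -/
def IsSIsostatic {d : ℕ}
    (τ : S →* (EuclideanSpace ℝ (Fin d) ≃ₗᵢ[ℝ] EuclideanSpace ℝ (Fin d)))
    (G : PinnedGraph V) (hG : G.IsSymmetric S) (c : QuotientLabelling S V) : Prop :=
  ∃ p : V → EuclideanSpace ℝ (Fin d), G.IsSymmetricAt τ p ∧
    (G.quotient hG c).IsIsostaticAt τ fun o => p (c.rep o)

/-- `(G, p)` is pinned `S`-regular: it is `S`-symmetric, and its pinned orbit matrix has maximal
rank among all `S`-symmetric realisations of `G`. -/
def IsSRegularAt {d : ℕ}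
    (τ : S →* (EuclideanSpace ℝ (Fin d) ≃ₗᵢ[ℝ] EuclideanSpace ℝ (Fin d)))
    (G : PinnedGraph V) (hG : G.IsSymmetric S) (c : QuotientLabelling S V)
    (p : V → EuclideanSpace ℝ (Fin d)) : Prop :=
  G.IsSymmetricAt τ p ∧
    ∀ q : V → EuclideanSpace ℝ (Fin d), G.IsSymmetricAt τ q →
      (G.orbitMatrix τ hG c q).rank ≤ (G.orbitMatrix τ hG c p).rank

/-- The pinned gain graph `L` is the projection of the pinned graph `K`. -/
def ProjectsTo {c : QuotientLabelling S V} (K : PinnedGraph V)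
    (L : PinnedGainGraph c.toGainGraph) : Prop :=
  (L.inner : Set (VertexOrbits S V)) = vertexOrbit S '' K.inner ∧
  (L.pinned : Set (VertexOrbits S V)) = vertexOrbit S '' K.pinned ∧
  (L.edges : Set (EdgeOrbits S V)) = edgeOrbit S '' K.edges

end PinnedGraph

/-- The lift of the pinned gain graph `L`, that is, its preimage under the covering map, is the
union of the pinned graphs in `𝒦`. -/
def PinnedGainGraph.LiftsTo {S V : Type*} [Group S] [MulAction S V] {c : QuotientLabelling S V}
    (L : PinnedGainGraph c.toGainGraph) (𝒦 : Set (PinnedGraph V)) : Prop :=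
  vertexOrbit S ⁻¹' L.inner = (⋃ K ∈ 𝒦, (K.inner : Set V)) ∧
  vertexOrbit S ⁻¹' L.pinned = (⋃ K ∈ 𝒦, (K.pinned : Set V)) ∧
  edgeOrbit S ⁻¹' L.edges = (⋃ K ∈ 𝒦, (K.edges : Set (Sym2 V)))

/-! ### Pinned incidence systems -/

/-! The Assur decomposition of an isostatic structure depends only on edge counts. If the matrix of
`G` is isostatic, independence of its rows shows that every set `X` of inner vertices induces at
most `d |X|` edges (edges whose inner ends all lie in `X`), with equality for the set of all inner
vertices. Call `X` tight if equality holds. By submodularity, tight sets are closed under union and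
intersection, so each inner vertex `v` lies in a least tight set, its closure. Membership in a
closure is a preorder on the inner vertices. The components of the decomposition are the classes of
this preorder, each with the edges that are induced by the closure and meet the class
(`Sparse.isComponent_iff`).

Linear algebra enters through `IsoAt.sparse` and `IsoAt.counts`: at every stage, a subsystem is
isostatic in some realisation exactly when it has `d` edges per inner vertex, because the
realisation of `G` then serves. All this is done for abstract incidence systems and applied both to
the graph and to its quotient.

An `S`-isostatic symmetric realisation has an orbit matrix of full row rank, so it is regular and
hence isostatic, and both levels are sparse. Freeness on vertices and edges multiplies both sides of
the count by `|S|`, so a set of orbits is tight exactly when its preimage is (`tight_cover_iff`).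
The closure of the orbit of `v` therefore lifts to the union of the closures of the translates `x •
v`. These closures all have the same size, so none contains another properly; this makes classes,
and with them components, lift to unions of translates of one class or component. -/

/-- The vertex and edge sets of a finite pinned (multi-, gain, hyper-) graph. The incidences are
given separately, by a function `ends : E → Set V`. -/
@[ext]
structure PinnedSystem (V E : Type*) where
  /-- the inner vertices -/
  inner : Finset V
  /-- the pinned vertices -/
  pinned : Finset V
  /-- the edges -/
  edges : Finset E

namespace PinnedSystem

variable {V E : Type*} {ends : E → Set V} {d : ℕ} {G K : PinnedSystem V E}

/-- No vertex is both inner and pinned, and the ends of all edges are vertices. -/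
structure Valid (ends : E → Set V) (K : PinnedSystem V E) : Prop where
  disjoint : Disjoint K.inner K.pinned
  mem_or_mem : ∀ e ∈ K.edges, ∀ v ∈ ends e, v ∈ K.inner ∨ v ∈ K.pinned

/-- Inclusion of pinned systems. -/
def IsSub (K G : PinnedSystem V E) : Prop :=
  K.inner ⊆ G.inner ∧ K.pinned ⊆ G.pinned ∧ K.edges ⊆ G.edges

theorem IsSub.trans {A B C : PinnedSystem V E} (h : A.IsSub B) (h' : B.IsSub C) : A.IsSub C :=
  ⟨h.1.trans h'.1, h.2.1.trans h'.2.1, h.2.2.trans h'.2.2⟩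

theorem IsSub.antisymm {A B : PinnedSystem V E} (h : A.IsSub B) (h' : B.IsSub A) : A = B :=
  PinnedSystem.ext (h.1.antisymm h'.1) (h.2.1.antisymm h'.2.1) (h.2.2.antisymm h'.2.2)

open Classical in
/-- Collapse the inner vertices in `A` into the ground. -/
noncomputable def ground (ends : E → Set V) (G : PinnedSystem V E) (A : Finset V) :
    PinnedSystem V E where
  inner := G.inner \ A
  pinned := G.pinned ∪ A
  edges := G.edges.filter fun e => ∃ v ∈ ends e, v ∈ G.inner ∧ v ∉ A

open Classical in
/-- The edges whose inner ends all lie in `X`. -/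
noncomputable def ind (ends : E → Set V) (G : PinnedSystem V E) (X : Finset V) : Finset E :=
  G.edges.filter fun e => ∀ v ∈ ends e, v ∈ G.inner → v ∈ X

theorem mem_ind {X : Finset V} {e : E} :
    e ∈ G.ind ends X ↔ e ∈ G.edges ∧ ∀ v ∈ ends e, v ∈ G.inner → v ∈ X := by
  classical
  simp [ind]

theorem ind_mono {X Y : Finset V} (h : X ⊆ Y) : G.ind ends X ⊆ G.ind ends Y := fun e he => by
  rw [mem_ind] at he ⊢
  exact ⟨he.1, fun v hv hv' => h (he.2 v hv hv')⟩

/-! ### Sparsity and tight sets -/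

/-- At most `d |X|` edges have all their inner ends in a set `X` of inner vertices, and there are
`d |I|` edges in total. -/
structure Sparse (ends : E → Set V) (d : ℕ) (G : PinnedSystem V E) : Prop where
  le : ∀ X ⊆ G.inner, (G.ind ends X).card ≤ d * X.card
  card_edges : G.edges.card = d * G.inner.card

/-- A set of inner vertices that attains the bound of sparsity. -/
def Tight (ends : E → Set V) (d : ℕ) (G : PinnedSystem V E) (X : Finset V) : Prop :=
  X ⊆ G.inner ∧ (G.ind ends X).card = d * X.card

theorem Sparse.ind_empty (h : G.Sparse ends d) : G.ind ends ∅ = ∅ := by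
  have := h.le ∅ (Finset.empty_subset _)
  simpa using this

theorem Sparse.tight_empty (h : G.Sparse ends d) : G.Tight ends d ∅ :=
  ⟨Finset.empty_subset _, by simp [h.ind_empty]⟩

theorem Sparse.tight_inner (h : G.Sparse ends d) : G.Tight ends d G.inner := by
  refine ⟨subset_rfl, ?_⟩
  rw [← h.card_edges]
  congr 1
  ext e
  rw [mem_ind]
  tauto

theorem Sparse.exists_end (h : G.Sparse ends d) {e : E} (he : e ∈ G.edges) :
    ∃ v ∈ ends e, v ∈ G.inner := by
  by_contra! hc
  have : e ∈ G.ind ends ∅ := mem_ind.2 ⟨he, fun v hv hv' => (hc v hv hv').elim⟩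
  simp [h.ind_empty] at this

section
open Classical

/-- Submodularity: `|ind X| + |ind Y| ≤ |ind (X ∪ Y)| + |ind (X ∩ Y)|`, while the sparsity bound for
the right side equals the left side, so all inequalities are equalities. The last conclusion says
that no edge joins `X \ Y` to `Y \ X`, nor is otherwise induced by the union alone. -/
theorem Sparse.union_inter (h : G.Sparse ends d) {X Y : Finset V} (hX : G.Tight ends d X)
    (hY : G.Tight ends d Y) : G.Tight ends d (X ∪ Y) ∧ G.Tight ends d (X ∩ Y) ∧
      G.ind ends (X ∪ Y) = G.ind ends X ∪ G.ind ends Y := by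
  have h1 : G.ind ends X ∪ G.ind ends Y ⊆ G.ind ends (X ∪ Y) :=
    Finset.union_subset (ind_mono Finset.subset_union_left) (ind_mono Finset.subset_union_right)
  have h2 : G.ind ends (X ∩ Y) = G.ind ends X ∩ G.ind ends Y := by
    ext e
    simp only [mem_ind, Finset.mem_inter]
    constructor
    · exact fun h => ⟨⟨h.1, fun v hv hv' => (h.2 v hv hv').1⟩,
        ⟨h.1, fun v hv hv' => (h.2 v hv hv').2⟩⟩
    · exact fun h => ⟨h.1.1, fun v hv hv' => ⟨h.1.2 v hv hv', h.2.2 v hv hv'⟩⟩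
  have hu : X ∪ Y ⊆ G.inner := Finset.union_subset hX.1 hY.1
  have hi : X ∩ Y ⊆ G.inner := Finset.inter_subset_left.trans hX.1
  have h3 := h.le _ hu
  have h4 := h.le _ hi
  have h5 := Finset.card_le_card h1
  have h6 := Finset.card_union_add_card_inter (G.ind ends X) (G.ind ends Y)
  have h7 := congrArg (d * ·) (Finset.card_union_add_card_inter X Y)
  simp only [mul_add] at h7
  rw [hX.2, hY.2, ← h2] at h6
  exact ⟨⟨hu, by omega⟩, ⟨hi, by omega⟩, (Finset.eq_of_subset_of_card_le h1 (by omega)).symm⟩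

/-! ### Closures and their classes -/

/-- The least tight set that contains `v`. -/
noncomputable def tightClosure (ends : E → Set V) (d : ℕ) (G : PinnedSystem V E) (v : V) :
    Finset V :=
  G.inner.filter fun w => ∀ X, G.Tight ends d X → v ∈ X → w ∈ X

/-- A finite intersection of tight sets is tight; the empty intersection is read as the set of all
inner vertices, which is tight by `card_edges`. -/
theorem Sparse.tight_tightClosure (h : G.Sparse ends d) (v : V) :
    G.Tight ends d (G.tightClosure ends d v) := by
  have key : ∀ s : Finset (Finset V), (∀ X ∈ s, G.Tight ends d X) →
      G.Tight ends d (G.inner.filter fun w => ∀ X ∈ s, w ∈ X) := by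
    intro s
    induction s using Finset.induction_on with
    | empty => intro _; simpa using h.tight_inner
    | insert X s _ ih =>
      intro hs
      have h1 := ih fun Y hY => hs Y (Finset.mem_insert_of_mem hY)
      have h2 := hs X (Finset.mem_insert_self _ _)
      have := (h.union_inter h2 h1).2.1
      convert this using 1
      ext w
      simp only [Finset.mem_filter, Finset.forall_mem_insert, Finset.mem_inter]
      tauto
  convert key (G.inner.powerset.filter fun X => G.Tight ends d X ∧ v ∈ X)
    (fun X hX => (Finset.mem_filter.1 hX).2.1) using 1
  ext w
  simp only [tightClosure, Finset.mem_filter, Finset.mem_powerset, and_congr_right_iff]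
  intro _
  exact ⟨fun h X hX => h X hX.2.1 hX.2.2, fun h X hX hv => h X ⟨hX.1, hX, hv⟩⟩

theorem mem_tightClosure_self {v : V} (hv : v ∈ G.inner) : v ∈ G.tightClosure ends d v := by
  simp [tightClosure, hv]

theorem Tight.tightClosure_subset {X : Finset V} (hX : G.Tight ends d X) {v : V} (hv : v ∈ X) :
    G.tightClosure ends d v ⊆ X := fun w hw => by
  simp only [tightClosure, Finset.mem_filter] at hw
  exact hw.2 X hX hv

theorem tightClosure_subset_inner (v : V) : G.tightClosure ends d v ⊆ G.inner :=
  Finset.filter_subset _ _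

theorem Sparse.tightClosure_mono (h : G.Sparse ends d) {v w : V}
    (hw : w ∈ G.tightClosure ends d v) : G.tightClosure ends d w ⊆ G.tightClosure ends d v :=
  (h.tight_tightClosure v).tightClosure_subset hw

theorem Sparse.biUnion (h : G.Sparse ends d) {ι : Type*} (s : Finset ι) (t : ι → Finset V)
    (ht : ∀ i ∈ s, G.Tight ends d (t i)) :
    G.Tight ends d (s.biUnion t) ∧ ∀ e ∈ G.ind ends (s.biUnion t), ∃ i ∈ s, e ∈ G.ind ends (t i) := by
  induction s using Finset.induction_on with
  | empty => simpa [h.ind_empty] using h.tight_empty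
  | insert i s _ ih =>
    obtain ⟨h1, h2⟩ := ih fun j hj => ht j (Finset.mem_insert_of_mem hj)
    obtain ⟨h3, -, h4⟩ := h.union_inter (ht i (Finset.mem_insert_self _ _)) h1
    rw [Finset.biUnion_insert]
    refine ⟨h3, fun e he => ?_⟩
    rw [h4, Finset.mem_union] at he
    rcases he with he | he
    · exact ⟨i, Finset.mem_insert_self _ _, he⟩
    · obtain ⟨j, hj, hj'⟩ := h2 e he
      exact ⟨j, Finset.mem_insert_of_mem hj, hj'⟩

/-- Every edge lies in the tight closure of one of its ends. -/
theorem Sparse.exists_mem_ind_tightClosure (h : G.Sparse ends d) {e : E} (he : e ∈ G.edges) :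
    ∃ v ∈ ends e, v ∈ G.inner ∧ e ∈ G.ind ends (G.tightClosure ends d v) := by
  -- The edge is induced by the union of the closures of its inner ends, and a union of tight sets
  -- induces no edge that none of its members induces.
  obtain ⟨v, hv, hv'⟩ := (h.biUnion (G.inner.filter (· ∈ ends e)) (G.tightClosure ends d)
    fun v _ => h.tight_tightClosure v).2 e (mem_ind.2 ⟨he, fun v hv hv' =>
      Finset.mem_biUnion.2 ⟨v, Finset.mem_filter.2 ⟨hv', hv⟩, mem_tightClosure_self hv'⟩⟩)
  rw [Finset.mem_filter] at hv
  exact ⟨v, hv.2, hv.1, hv'⟩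

/-- The inner vertices with the same tight closure as `v`. -/
noncomputable def tightClass (ends : E → Set V) (d : ℕ) (G : PinnedSystem V E) (v : V) :
    Finset V :=
  G.inner.filter fun w => G.tightClosure ends d w = G.tightClosure ends d v

theorem mem_tightClass {v w : V} : w ∈ G.tightClass ends d v ↔
    w ∈ G.inner ∧ G.tightClosure ends d w = G.tightClosure ends d v := by
  simp [tightClass]

theorem tightClass_subset (v : V) : G.tightClass ends d v ⊆ G.tightClosure ends d v :=
  fun w hw => by
    rw [mem_tightClass] at hw
    rw [← hw.2]
    exact mem_tightClosure_self hw.1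

theorem tightClass_congr {v w : V} (h : G.tightClosure ends d w = G.tightClosure ends d v) :
    G.tightClass ends d w = G.tightClass ends d v := by
  ext u
  simp [mem_tightClass, h]

/-! ### Components attached to the classes -/

/-- The component of `v` in the decomposition. -/
noncomputable def comp (ends : E → Set V) (d : ℕ) (G : PinnedSystem V E) (v : V) :
    PinnedSystem V E where
  inner := G.tightClass ends d v
  pinned := (G.inner ∪ G.pinned).filter fun w => w ∉ G.tightClass ends d v ∧
    ∃ e ∈ G.ind ends (G.tightClosure ends d v), w ∈ ends e ∧
      ∃ a ∈ ends e, a ∈ G.tightClass ends d v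
  edges := (G.ind ends (G.tightClosure ends d v)).filter fun e =>
    ∃ a ∈ ends e, a ∈ G.tightClass ends d v

theorem mem_comp_edges {v : V} {e : E} : e ∈ (G.comp ends d v).edges ↔
    e ∈ G.ind ends (G.tightClosure ends d v) ∧ ∃ a ∈ ends e, a ∈ G.tightClass ends d v := by
  simp [comp]

theorem mem_comp_pinned {v w : V} : w ∈ (G.comp ends d v).pinned ↔
    (w ∈ G.inner ∨ w ∈ G.pinned) ∧ w ∉ G.tightClass ends d v ∧
      ∃ e ∈ (G.comp ends d v).edges, w ∈ ends e := by
  simp only [comp, Finset.mem_filter, Finset.mem_union]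
  grind

theorem comp_congr {v w : V} (h : G.tightClosure ends d w = G.tightClosure ends d v) :
    G.comp ends d w = G.comp ends d v := by
  simp only [comp, h, tightClass_congr h]

theorem comp_edges_subset (v : V) : (G.comp ends d v).edges ⊆ G.edges := fun _ he =>
  (mem_ind.1 (mem_comp_edges.1 he).1).1

theorem valid_comp (hG : G.Valid ends) (v : V) : (G.comp ends d v).Valid ends where
  disjoint := by
    rw [Finset.disjoint_left]
    intro w hw hw'
    exact (mem_comp_pinned.1 hw').2.1 hw
  mem_or_mem e he w hw := by
    by_cases h : w ∈ G.tightClass ends d v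
    · exact Or.inl h
    · exact Or.inr (mem_comp_pinned.2
        ⟨hG.mem_or_mem e (comp_edges_subset v he) w hw, h, e, he, hw⟩)

/-- What lies strictly below `v` is closed downwards, hence is the union of the closures of its
elements. -/
theorem Sparse.tight_sdiff_tightClass (h : G.Sparse ends d) (v : V) :
    G.Tight ends d (G.tightClosure ends d v \ G.tightClass ends d v) := by
  convert (h.biUnion (G.tightClosure ends d v \ G.tightClass ends d v) (G.tightClosure ends d)
    fun v _ => h.tight_tightClosure v).1 using 1
  ext w
  simp only [Finset.mem_biUnion, Finset.mem_sdiff]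
  constructor
  · intro hw
    exact ⟨w, hw, mem_tightClosure_self (tightClosure_subset_inner _ hw.1)⟩
  · rintro ⟨u, ⟨hu, hu'⟩, hw⟩
    refine ⟨h.tightClosure_mono hu hw, fun hw' => hu' ?_⟩
    rw [mem_tightClass] at hw' ⊢
    refine ⟨tightClosure_subset_inner _ hu, (h.tightClosure_mono hu).antisymm ?_⟩
    rw [← hw'.2]
    exact h.tightClosure_mono hw

/-- The edges are those induced by the closure but not by the part strictly below `v`. Both sets are
tight, so their counts subtract. -/
theorem Sparse.card_comp_edges (h : G.Sparse ends d) (v : V) :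
    (G.comp ends d v).edges.card = d * (G.comp ends d v).inner.card := by
  set N := G.tightClosure ends d v \ G.tightClass ends d v with hN
  have h1 : (G.comp ends d v).edges = G.ind ends (G.tightClosure ends d v) \ G.ind ends N := by
    ext e
    rw [mem_comp_edges, Finset.mem_sdiff]
    refine and_congr_right fun he => ?_
    constructor
    · rintro ⟨a, ha, ha'⟩ h
      have := (mem_ind.1 h).2 a ha (mem_tightClass.1 ha').1
      rw [hN, Finset.mem_sdiff] at this
      exact this.2 ha'
    · intro h
      by_contra! hc
      refine h (mem_ind.2 ⟨(mem_ind.1 he).1, fun a ha ha' => ?_⟩)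
      rw [hN, Finset.mem_sdiff]
      exact ⟨(mem_ind.1 he).2 a ha ha', hc a ha⟩
  have h2 := Finset.card_sdiff_add_card_eq_card (tightClass_subset (G := G) (ends := ends)
    (d := d) v)
  have h3 := Finset.card_sdiff_add_card_eq_card
    (ind_mono (G := G) (ends := ends) (Finset.sdiff_subset : N ⊆ G.tightClosure ends d v))
  rw [← h1, (h.tight_tightClosure v).2, (h.tight_sdiff_tightClass v).2, ← hN] at h3
  rw [← hN] at h2
  have h4 := congrArg (d * ·) h2
  simp only [mul_add] at h4
  change _ = d * (G.tightClass ends d v).card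
  omega

/-- A stage of the decomposition contains the component of `v` as soon as everything below it has
been collapsed. -/
theorem comp_isSub_ground {Y : Finset V} (hY : G.Tight ends d Y)
    {v : V} (hvi : v ∈ G.inner) (hvY : v ∉ Y)
    (hv : G.tightClosure ends d v \ G.tightClass ends d v ⊆ Y) :
    (G.comp ends d v).IsSub (G.ground ends Y) := by
  have hcls : ∀ w ∈ G.tightClass ends d v, w ∈ G.inner ∧ w ∉ Y := fun w hw => by
    have hw' := mem_tightClass.1 hw
    exact ⟨hw'.1, fun hwY => hvY
      (hY.tightClosure_subset hwY (hw'.2 ▸ mem_tightClosure_self hvi))⟩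
  refine ⟨fun w hw => Finset.mem_sdiff.2 (hcls w hw), fun w hw => ?_, fun e he => ?_⟩
  · obtain ⟨hw1, hw2, e, he, hwe⟩ := mem_comp_pinned.1 hw
    rcases hw1 with hw1 | hw1
    · exact Finset.mem_union_right _ (hv (Finset.mem_sdiff.2
        ⟨(mem_ind.1 (mem_comp_edges.1 he).1).2 w hwe hw1, hw2⟩))
    · exact Finset.mem_union_left _ hw1
  · obtain ⟨a, ha, ha'⟩ := (mem_comp_edges.1 he).2
    exact Finset.mem_filter.2 ⟨comp_edges_subset v he, a, ha, hcls a ha'⟩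


theorem ground_ground (A B : Finset V) :
    (G.ground ends A).ground ends B = G.ground ends (A ∪ B) := by
  ext x
  · simp only [ground, Finset.mem_sdiff, Finset.mem_union]; tauto
  · simp only [ground, Finset.mem_union]; tauto
  · simp only [ground, Finset.mem_filter, Finset.mem_sdiff, Finset.mem_union]; grind

theorem Sparse.ground_empty (h : G.Sparse ends d) : G.ground ends ∅ = G := by
  ext x
  · simp [ground]
  · simp [ground]
  · simpa [ground] using fun hx => h.exists_end hx

/-- A subsystem with `d` edges per inner vertex of a stage of the decomposition contains a
component. -/
theorem Sparse.exists_comp_isSub (h : G.Sparse ends d) (hG : G.Valid ends) {Y : Finset V}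
    (hY : G.Tight ends d Y) (hK : K.Valid ends) (hKY : K.IsSub (G.ground ends Y))
    (hne : K.inner.Nonempty) (hcard : K.edges.card = d * K.inner.card) :
    ∃ v ∈ K.inner, (G.comp ends d v).IsSub K ∧
      G.tightClosure ends d v \ G.tightClass ends d v ⊆ Y := by
  obtain ⟨hK1, hK2, hK3⟩ := hKY
  have hin : ∀ w ∈ K.inner, w ∈ G.inner ∧ w ∉ Y := fun w hw => Finset.mem_sdiff.1 (hK1 hw)
  have hdY : Disjoint Y K.inner := Finset.disjoint_right.2 fun w hw => (hin w hw).2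
  have hsub : K.edges ⊆ G.ind ends (Y ∪ K.inner) := fun e he => by
    refine mem_ind.2 ⟨(Finset.mem_filter.1 (hK3 he)).1, fun w hw hw' => ?_⟩
    rcases hK.mem_or_mem e he w hw with h1 | h1
    · exact Finset.mem_union_right _ h1
    · rcases Finset.mem_union.1 (hK2 h1) with h2 | h2
      -- A vertex that is pinned in `K` but inner in `G` must have been collapsed, so it belongs to
      -- `Y`.
      · exact (Finset.disjoint_left.1 hG.disjoint hw' h2).elim
      · exact Finset.mem_union_left _ h2
  have hdE : Disjoint (G.ind ends Y) K.edges := Finset.disjoint_right.2 fun e he he' => by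
    obtain ⟨a, ha, ha', ha''⟩ := (Finset.mem_filter.1 (hK3 he)).2
    exact ha'' ((mem_ind.1 he').2 a ha ha')
  have hXi : Y ∪ K.inner ⊆ G.inner := Finset.union_subset hY.1 fun w hw => (hin w hw).1
  have hss : G.ind ends Y ∪ K.edges ⊆ G.ind ends (Y ∪ K.inner) :=
    Finset.union_subset (ind_mono Finset.subset_union_left) hsub
  have hc1 := h.le _ hXi
  have hc2 := Finset.card_le_card hss
  rw [Finset.card_union_of_disjoint hdY, mul_add] at hc1
  rw [Finset.card_union_of_disjoint hdE, hY.2, hcard] at hc2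
  -- The disjoint sets `ind Y` and `K.edges` already supply `d |Y ∪ K.inner|` edges, the maximum
  -- allowed. So the union is tight and induces no further edges.
  have hX : G.Tight ends d (Y ∪ K.inner) :=
    ⟨hXi, by rw [Finset.card_union_of_disjoint hdY, mul_add]; omega⟩
  have hE : G.ind ends Y ∪ K.edges = G.ind ends (Y ∪ K.inner) :=
    Finset.eq_of_subset_of_card_le hss
      (by rw [Finset.card_union_of_disjoint hdE, hY.2, hcard]; omega)
  -- With the closure of `v` of least size, every vertex of `K.inner` below `v` is equivalent to
  -- `v`, so everything strictly below `v` lies in `Y`.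
  obtain ⟨v, hv, hmin⟩ := K.inner.exists_min_image (fun v => (G.tightClosure ends d v).card) hne
  have htX : G.tightClosure ends d v ⊆ Y ∪ K.inner :=
    hX.tightClosure_subset (Finset.mem_union_right _ hv)
  have hcls : ∀ w ∈ G.tightClass ends d v, w ∈ K.inner ∧ w ∉ Y := fun w hw => by
    have hwY : w ∉ Y := fun hwY => (hin v hv).2
      (hY.tightClosure_subset hwY ((mem_tightClass.1 hw).2 ▸ mem_tightClosure_self (hin v hv).1))
    exact ⟨(Finset.mem_union.1 (htX (tightClass_subset _ hw))).resolve_left hwY, hwY⟩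
  have hrest : G.tightClosure ends d v \ G.tightClass ends d v ⊆ Y := fun z hz => by
    rw [Finset.mem_sdiff] at hz
    by_contra hzY
    have hzK := (Finset.mem_union.1 (htX hz.1)).resolve_left hzY
    exact hz.2 (mem_tightClass.2 ⟨(hin z hzK).1,
      Finset.eq_of_subset_of_card_le (h.tightClosure_mono hz.1) (hmin z hzK)⟩)
  have hedges : (G.comp ends d v).edges ⊆ K.edges := fun e he => by
    obtain ⟨he1, a, ha, ha'⟩ := mem_comp_edges.1 he
    have he2 := ind_mono htX he1
    rw [← hE, Finset.mem_union] at he2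
    refine he2.resolve_left fun he3 => (hcls a ha').2 ((mem_ind.1 he3).2 a ha ?_)
    exact (mem_tightClass.1 ha').1
  refine ⟨v, hv, ⟨fun w hw => (hcls w hw).1, fun w hw => ?_, hedges⟩, hrest⟩
  obtain ⟨-, hw2, e, he, hwe⟩ := mem_comp_pinned.1 hw
  refine (hK.mem_or_mem e (hedges he) w hwe).resolve_left fun hwK => (hin w hwK).2 (hrest ?_)
  exact Finset.mem_sdiff.2 ⟨(mem_ind.1 (mem_comp_edges.1 he).1).2 w hwe (hin w hwK).1, hw2⟩

/-! ### The decomposition of a sparse system -/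

/-- `K` is minimal among the valid systems with the property `P` that have an inner vertex. -/
def IsMinimal (ends : E → Set V) (P : PinnedSystem V E → Prop) (K : PinnedSystem V E) : Prop :=
  K.Valid ends ∧ K.inner.Nonempty ∧ P K ∧
    ∀ K' : PinnedSystem V E, K'.Valid ends → K'.IsSub K → K'.inner.Nonempty → P K' → K' = K

/-- The components of the decomposition into minimal systems with the property `P`. -/
inductive IsComponent (ends : E → Set V) (P : PinnedSystem V E → Prop) :
    PinnedSystem V E → PinnedSystem V E → Prop
  | bottom {G K : PinnedSystem V E} : K.IsSub G → K.IsMinimal ends P → IsComponent ends P G K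
  | above {G A K : PinnedSystem V E} : A.IsSub G → A.IsMinimal ends P →
      IsComponent ends P (G.ground ends A.inner) K → IsComponent ends P G K

/-- In the stages of the decomposition of `G`, the property `P` means having `d` edges per inner
vertex. -/
def Counts (ends : E → Set V) (d : ℕ) (P : PinnedSystem V E → Prop) (G : PinnedSystem V E) :
    Prop :=
  ∀ Y, G.Tight ends d Y → ∀ K : PinnedSystem V E, K.Valid ends → K.IsSub (G.ground ends Y) →
    (P K ↔ K.edges.card = d * K.inner.card)

variable {P : PinnedSystem V E → Prop}

/-- By its count, `K` contains some `comp`, which itself has the right count and therefore `P`;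
minimality forces equality. -/
theorem Sparse.eq_comp_of_isMinimal (h : G.Sparse ends d) (hG : G.Valid ends)
    (hP : G.Counts ends d P) {Y : Finset V} (hY : G.Tight ends d Y)
    (hKY : K.IsSub (G.ground ends Y)) (hK : K.IsMinimal ends P) :
    ∃ v ∈ G.inner, v ∉ Y ∧ K = G.comp ends d v ∧
      G.tightClosure ends d v \ G.tightClass ends d v ⊆ Y := by
  obtain ⟨hK1, hK2, hK3, hK4⟩ := hK
  obtain ⟨v, hv, hsub, hv'⟩ := h.exists_comp_isSub hG hY hK1 hKY hK2 ((hP Y hY K hK1 hKY).1 hK3)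
  have hvG := Finset.mem_sdiff.1 (hKY.1 hv)
  refine ⟨v, hvG.1, hvG.2, (hK4 _ (valid_comp hG v) hsub
    ⟨v, mem_tightClass.2 ⟨hvG.1, rfl⟩⟩ ?_).symm, hv'⟩
  exact (hP Y hY _ (valid_comp hG v) (hsub.trans hKY)).2 (h.card_comp_edges v)

/-- A smaller system with `P` contains the component of one of its inner vertices, which is
equivalent to `v` and so yields the same component. -/
theorem Sparse.isMinimal_comp (h : G.Sparse ends d) (hG : G.Valid ends)
    (hP : G.Counts ends d P) {Y : Finset V} (hY : G.Tight ends d Y) {v : V} (hvi : v ∈ G.inner)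
    (hvY : v ∉ Y) (hv : G.tightClosure ends d v \ G.tightClass ends d v ⊆ Y) :
    (G.comp ends d v).IsMinimal ends P := by
  have hsub := comp_isSub_ground hY hvi hvY hv
  refine ⟨valid_comp hG v, ⟨v, mem_tightClass.2 ⟨hvi, rfl⟩⟩,
    (hP Y hY _ (valid_comp hG v) hsub).2 (h.card_comp_edges v), fun K' h1 h2 h3 h4 => ?_⟩
  have h5 := h2.trans hsub
  obtain ⟨w, hw, hw', -⟩ := h.exists_comp_isSub hG hY h1 h5 h3 ((hP Y hY _ h1 h5).1 h4)
  rw [comp_congr (mem_tightClass.1 (h2.1 hw)).2] at hw'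
  exact h2.antisymm hw'

/-- The components of the decomposition are the systems `G.comp ends d v`. -/
theorem Sparse.isComponent_iff (h : G.Sparse ends d) (hG : G.Valid ends)
    (hP : G.Counts ends d P) :
    G.IsComponent ends P K ↔ ∃ v ∈ G.inner, K = G.comp ends d v := by
  -- Collapsing keeps the collapsed set tight: adding the class of `v` to `Y` amounts to adding its
  -- whole closure.
  have hunion : ∀ {Y : Finset V} {v : V}, v ∈ G.inner → G.Tight ends d Y →
      G.tightClosure ends d v \ G.tightClass ends d v ⊆ Y →
      G.Tight ends d (Y ∪ (G.comp ends d v).inner) := by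
    intro Y v hv hY hvY
    convert (h.union_inter hY (h.tight_tightClosure v)).1 using 1
    ext w
    have h1 := @hvY w
    have h2 := @tightClass_subset _ _ ends d G v w
    simp only [Finset.mem_union, Finset.mem_sdiff] at h1 ⊢
    change _ ∨ w ∈ G.tightClass ends d v ↔ _
    tauto
  constructor
  · have key : ∀ G' : PinnedSystem V E, G'.IsComponent ends P K → ∀ Y, G.Tight ends d Y →
        G' = G.ground ends Y → ∃ v ∈ G.inner, K = G.comp ends d v := by
      intro G' hc
      induction hc with
      | bottom h1 h2 =>
        rintro Y hY rfl
        obtain ⟨v, hv, -, hv', -⟩ := h.eq_comp_of_isMinimal hG hP hY h1 h2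
        exact ⟨v, hv, hv'⟩
      | above h1 h2 _ ih =>
        rintro Y hY rfl
        obtain ⟨v, hv, -, rfl, hv'⟩ := h.eq_comp_of_isMinimal hG hP hY h1 h2
        exact ih _ (hunion hv hY hv') (ground_ground _ _)
    exact fun hc => key G hc ∅ h.tight_empty h.ground_empty.symm
  · rintro ⟨v, hv, rfl⟩
    have key : ∀ n, ∀ Y : Finset V, (G.inner \ Y).card = n → G.Tight ends d Y → v ∉ Y →
        (G.ground ends Y).IsComponent ends P (G.comp ends d v) := by
      intro n
      induction n using Nat.strong_induction_on with
      | _ n ih =>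
        intro Y hn hY hvY
        -- A minimal uncollapsed vertex below `v` has everything strictly below it in `Y`, so its
        -- component can be chosen next. Either this is the component of `v`, or collapsing it
        -- leaves `v` untouched and fewer inner vertices remain.
        obtain ⟨u, hu, hmin⟩ := (G.tightClosure ends d v \ Y).exists_min_image
          (fun u => (G.tightClosure ends d u).card)
          ⟨v, Finset.mem_sdiff.2 ⟨mem_tightClosure_self hv, hvY⟩⟩
        rw [Finset.mem_sdiff] at hu
        have hui := tightClosure_subset_inner _ hu.1
        have huY : G.tightClosure ends d u \ G.tightClass ends d u ⊆ Y := fun z hz => by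
          rw [Finset.mem_sdiff] at hz
          by_contra hzY
          exact hz.2 (mem_tightClass.2 ⟨tightClosure_subset_inner _ hz.1,
            Finset.eq_of_subset_of_card_le (h.tightClosure_mono hz.1)
              (hmin z (Finset.mem_sdiff.2 ⟨h.tightClosure_mono hu.1 hz.1, hzY⟩))⟩)
        have hsub := comp_isSub_ground hY hui hu.2 huY
        have hm := h.isMinimal_comp hG hP hY hui hu.2 huY
        by_cases huv : u ∈ G.tightClass ends d v
        · rw [comp_congr (mem_tightClass.1 huv).2] at hsub hm
          exact .bottom hsub hm
        · refine .above hsub hm ?_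
          rw [ground_ground]
          have huu : u ∈ (G.comp ends d u).inner := mem_tightClass.2 ⟨hui, rfl⟩
          refine ih _ ?_ _ rfl (hunion hui hY huY) ?_
          · rw [← hn]
            refine Finset.card_lt_card (Finset.ssubset_iff_of_subset ?_ |>.2 ⟨u, ?_, ?_⟩)
            · exact Finset.sdiff_subset_sdiff subset_rfl Finset.subset_union_left
            · exact Finset.mem_sdiff.2 ⟨hui, hu.2⟩
            · simp [huu]
          · rw [Finset.mem_union]
            rintro (h1 | h1)
            · exact hvY h1
            · exact huv (mem_tightClass.2 ⟨hui, ((mem_tightClass.1 h1).2).symm⟩)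
    have := key _ ∅ rfl h.tight_empty (Finset.notMem_empty v)
    rwa [h.ground_empty] at this

end

end PinnedSystem

/-! ### From isostatic matrices to edge counts -/

namespace PinnedSystem

variable {V E : Type*} {ends : E → Set V} {d : ℕ} {G K : PinnedSystem V E}

/-- The matrix with a row for each edge of `K` and `d` columns for each inner vertex of `K`, with
the entries given by `R`. -/
def toMatrix (R : E → V → Fin d → ℝ) (K : PinnedSystem V E) :
    Matrix K.edges (K.inner × Fin d) ℝ :=
  fun e c => R e.1 c.1.1 c.2

/-- The matrix of `K` has trivial kernel and independent rows. -/
def IsoAt (R : E → V → Fin d → ℝ) (K : PinnedSystem V E) : Prop :=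
  (∀ U : K.inner × Fin d → ℝ, (K.toMatrix R).mulVec U = 0 → U = 0) ∧
    LinearIndependent ℝ (K.toMatrix R).row

variable {R : E → V → Fin d → ℝ}

theorem card_edges_le_of_linearIndependent (h : LinearIndependent ℝ (K.toMatrix R).row) :
    K.edges.card ≤ d * K.inner.card := by
  have := h.fintype_card_le_finrank
  simpa [mul_comm] using this

theorem IsoAt.card_edges (h : K.IsoAt R) : K.edges.card = d * K.inner.card := by
  refine (card_edges_le_of_linearIndependent h.2).antisymm ?_
  have hinj : Function.Injective (K.toMatrix R).mulVecLin := by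
    rw [← LinearMap.ker_eq_bot, LinearMap.ker_eq_bot']
    exact h.1
  have := LinearMap.finrank_le_finrank_of_injective hinj
  simpa [mul_comm] using this

/-- The edge count makes the matrix square, and rank-nullity turns full row rank into a trivial
kernel. -/
theorem isoAt_of_linearIndependent (h : LinearIndependent ℝ (K.toMatrix R).row)
    (hc : K.edges.card = d * K.inner.card) : K.IsoAt R := by
  refine ⟨?_, h⟩
  have h1 := h.rank_matrix
  have h2 := LinearMap.finrank_range_add_finrank_ker (K.toMatrix R).mulVecLin
  rw [Matrix.rank] at h1
  have h3 : Module.finrank ℝ (LinearMap.ker (K.toMatrix R).mulVecLin) = 0 := by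
    rw [h1] at h2
    simp only [Module.finrank_fintype_fun_eq_card, Fintype.card_prod, Fintype.card_coe,
      Fintype.card_fin, hc] at h2
    rw [mul_comm] at h2
    omega
  have h4 := Submodule.finrank_eq_zero.1 h3
  exact LinearMap.ker_eq_bot'.1 h4

theorem isoAt_of_rigid (h : ∀ U : K.inner × Fin d → ℝ, (K.toMatrix R).mulVec U = 0 → U = 0)
    (hc : K.edges.card = d * K.inner.card) : K.IsoAt R := by
  refine ⟨h, ?_⟩
  have h2 := LinearMap.finrank_range_add_finrank_ker (K.toMatrix R).mulVecLin
  rw [LinearMap.ker_eq_bot'.2 h] at h2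
  rw [linearIndependent_iff_card_eq_finrank_span, Set.finrank, ← Matrix.rank_eq_finrank_span_row,
    Matrix.rank]
  simp only [finrank_bot, Module.finrank_fintype_fun_eq_card, Fintype.card_prod,
    Fintype.card_coe, Fintype.card_fin] at h2 ⊢
  rw [hc, mul_comm]
  omega

/-- Weights live on all of `E`, not on a subtype, so that those of a subsystem can be extended by
zero. `rigid_iff` does the same for motions. -/
theorem linearIndependent_row_iff : LinearIndependent ℝ (K.toMatrix R).row ↔
    ∀ g : E → ℝ, (∀ v ∈ K.inner, ∀ k, ∑ e ∈ K.edges, g e * R e v k = 0) →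
      ∀ e ∈ K.edges, g e = 0 := by
  classical
  rw [Fintype.linearIndependent_iff]
  constructor
  · intro h g hg e he
    refine h (fun e => g e) ?_ ⟨e, he⟩
    ext c
    have := hg c.1.1 c.1.2 c.2
    rw [← Finset.sum_coe_sort] at this
    simpa [toMatrix] using this
  · intro h g hg e
    have := h (fun e => if he : e ∈ K.edges then g ⟨e, he⟩ else 0) (fun v hv k => ?_) e.1 e.2
    · simpa using this
    · have := congrFun hg (⟨v, hv⟩, k)
      rw [← Finset.sum_coe_sort]
      simpa [toMatrix] using this

theorem rigid_iff : (∀ U : K.inner × Fin d → ℝ, (K.toMatrix R).mulVec U = 0 → U = 0) ↔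
    ∀ U : V → Fin d → ℝ, (∀ e ∈ K.edges, ∑ v ∈ K.inner, ∑ k, R e v k * U v k = 0) →
      ∀ v ∈ K.inner, U v = 0 := by
  classical
  constructor
  · intro h U hU v hv
    have := h (fun c => U c.1 c.2) ?_
    · ext k
      exact congrFun this (⟨v, hv⟩, k)
    · ext e
      have := hU e.1 e.2
      rw [← Finset.sum_coe_sort] at this
      simpa [toMatrix, Matrix.mulVec, dotProduct, Fintype.sum_prod_type] using this
  · intro h U hU
    ext ⟨v, k⟩
    have := h (fun v k => if hv : v ∈ K.inner then U (⟨v, hv⟩, k) else 0) (fun e he => ?_) v.1 v.2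
    · simpa using congrFun this k
    · have := congrFun hU ⟨e, he⟩
      rw [← Finset.sum_coe_sort]
      simpa [toMatrix, Matrix.mulVec, dotProduct, Fintype.sum_prod_type] using this

/-- Rows of a subsystem are independent, since they vanish outside its inner vertices. -/
theorem linearIndependent_of_isSub (hR : ∀ e v, v ∉ ends e → R e v = 0)
    (hG : Disjoint G.inner G.pinned) (hK : K.Valid ends) (hKG : K.IsSub G)
    (h : LinearIndependent ℝ (G.toMatrix R).row) : LinearIndependent ℝ (K.toMatrix R).row := by
  classical
  rw [linearIndependent_row_iff] at h ⊢
  intro g hg e he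
  have := h (fun e => if e ∈ K.edges then g e else 0) (fun v hv k => ?_) e (hKG.2.2 he)
  · simpa [he] using this
  · simp only [ite_mul, zero_mul, Finset.sum_ite_mem, Finset.inter_eq_right.2 hKG.2.2]
    by_cases hvK : v ∈ K.inner
    · exact hg v hvK k
    · refine Finset.sum_eq_zero fun e he => ?_
      -- An inner vertex of `G` outside `K.inner` is no end of an edge of `K`: it would be pinned in
      -- `K`, hence in `G`.
      rw [hR e v fun hve => ?_, Pi.zero_apply, mul_zero]
      exact Finset.disjoint_left.1 hG hv (hKG.2.1 ((hK.mem_or_mem e he v hve).resolve_left hvK))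

/-- Collapsing inner vertices into the ground preserves rigidity. -/
theorem rigid_ground (hR : ∀ e v, v ∉ ends e → R e v = 0) (Y : Finset V)
    (h : ∀ U : G.inner × Fin d → ℝ, (G.toMatrix R).mulVec U = 0 → U = 0) :
    ∀ U : (G.ground ends Y).inner × Fin d → ℝ,
      ((G.ground ends Y).toMatrix R).mulVec U = 0 → U = 0 := by
  classical
  rw [rigid_iff] at h ⊢
  intro U hU v hv
  simp only [ground, Finset.mem_sdiff] at hv
  -- The motion is extended by zero on `Y`. The dropped edges have all their inner ends in `Y`, so
  -- they impose no condition on it.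
  have := h (fun v => if v ∈ Y then 0 else U v) (fun e he => ?_) v hv.1
  · simpa [hv.2] using this
  · by_cases hY : e ∈ (G.ground ends Y).edges
    · rw [← hU e hY]
      have hsub : (G.ground ends Y).inner ⊆ G.inner := Finset.sdiff_subset
      refine (Finset.sum_subset hsub fun w hw hw' => ?_).symm.trans
        (Finset.sum_congr rfl fun w hw => ?_)
      · have : w ∈ Y := by
          by_contra hc
          exact hw' (Finset.mem_sdiff.2 ⟨hw, hc⟩)
        simp [this]
      · simp [(Finset.mem_sdiff.1 hw).2]
    · refine Finset.sum_eq_zero fun w hw => Finset.sum_eq_zero fun k _ => ?_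
      by_cases hwe : w ∈ ends e
      · have : w ∈ Y := by
          by_contra hc
          exact hY (Finset.mem_filter.2 ⟨he, w, hwe, hw, hc⟩)
        simp [this]
      · simp [hR e w hwe]

/-- The edges induced by `X` have independent rows supported on the `d |X|` columns of `X`. -/
theorem IsoAt.sparse (hR : ∀ e v, v ∉ ends e → R e v = 0) (hG : G.Valid ends) (h : G.IsoAt R) :
    G.Sparse ends d where
  card_edges := h.card_edges
  le X hX := by
    refine card_edges_le_of_linearIndependent (K := ⟨X, G.pinned, G.ind ends X⟩)
      (linearIndependent_of_isSub hR hG.disjoint ⟨?_, ?_⟩ ⟨hX, subset_rfl, ?_⟩ h.2)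
    · exact Finset.disjoint_of_subset_left hX hG.disjoint
    · intro e he v hv
      rw [mem_ind] at he
      exact (hG.mem_or_mem e he.1 v hv).imp_left (he.2 v hv)
    · exact fun e he => (mem_ind.1 he).1

/-- If `G` is isostatic, the subsystems of the stages of its decomposition are isostatic as soon
as they have the right number of edges. -/
theorem IsoAt.counts (hR : ∀ e v, v ∉ ends e → R e v = 0) (hG : G.Valid ends) (h : G.IsoAt R)
    {P : PinnedSystem V E → Prop} 
    (hP : ∀ K, K.Valid ends → K.edges ⊆ G.edges → K.IsoAt R → P K)
    (hP' : ∀ K, P K → K.edges.card = d * K.inner.card) : G.Counts ends d P := by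
  classical
  intro Y hY K hK hKY
  refine ⟨hP' K, fun hc => hP K hK
    (hKY.2.2.trans (Finset.filter_subset _ _)) (isoAt_of_linearIndependent ?_ hc)⟩
  -- The stage itself is rigid, and square because `Y` is tight; so its rows are independent, and
  -- those of `K` with them.
  refine linearIndependent_of_isSub hR ?_ hK hKY
    (isoAt_of_rigid (rigid_ground hR Y h.1) ?_).2
  · rw [Finset.disjoint_left]
    intro v hv hv'
    simp only [ground, Finset.mem_sdiff, Finset.mem_union] at hv hv'
    exact hv'.elim (Finset.disjoint_left.1 hG.disjoint hv.1) hv.2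
  · have h1 : (G.ground ends Y).edges = G.edges \ G.ind ends Y := by
      ext e
      simp only [ground, Finset.mem_filter, Finset.mem_sdiff, mem_ind]
      grind
    have h2 := Finset.card_sdiff_add_card_eq_card
      (fun e he => (mem_ind.1 he).1 : G.ind ends Y ⊆ G.edges)
    have h3 := Finset.card_sdiff_add_card_eq_card hY.1
    have h4 := congrArg (d * ·) h3
    simp only [mul_add] at h4
    rw [h.card_edges, hY.2] at h2
    rw [h1]
    change _ = d * (G.inner \ Y).card
    convert Nat.add_right_cancel (h2.trans h4.symm)

end PinnedSystem

/-! ### Pinned graphs and pinned gain graphs as pinned incidence systems -/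

namespace PinnedGraph

variable {V : Type*} {d : ℕ}

/-- The underlying pinned system of a pinned graph. -/
def toSystem (G : PinnedGraph V) : PinnedSystem V (Sym2 V) := ⟨G.inner, G.pinned, G.edges⟩

theorem toSystem_injective : Function.Injective (toSystem (V := V)) := by
  rintro ⟨⟩ ⟨⟩ h
  simp only [toSystem, PinnedSystem.mk.injEq] at h
  obtain ⟨rfl, rfl, rfl⟩ := h
  rfl

/-- The ends of an unordered pair. -/
def ends (e : Sym2 V) : Set V := {v | v ∈ e}

theorem mem_ends {e : Sym2 V} {v : V} : v ∈ ends e ↔ v ∈ e := Iff.rfl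

theorem valid_toSystem (G : PinnedGraph V) : G.toSystem.Valid ends := ⟨G.disjoint, G.mem_or_mem⟩

theorem exists_toSystem_eq {G : PinnedGraph V} {K : PinnedSystem V (Sym2 V)} (hK : K.Valid ends)
    (h : K.edges ⊆ G.edges) : ∃ K' : PinnedGraph V, K'.toSystem = K :=
  ⟨⟨K.inner, K.pinned, K.edges, hK.disjoint, fun e he => G.loopless e (h he), hK.mem_or_mem⟩, rfl⟩

/-- The property of a pinned system to come from a pinned `d`-isostatic graph. -/
def SystemIso (d : ℕ) (K : PinnedSystem V (Sym2 V)) : Prop :=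
  ∃ K' : PinnedGraph V, K'.toSystem = K ∧ K'.IsIsostatic d

theorem isMinimal_toSystem_iff {K : PinnedGraph V} :
    K.toSystem.IsMinimal ends (SystemIso d) ↔ K.IsAssur d := by
  have hiso : ∀ K : PinnedGraph V, SystemIso d K.toSystem ↔ K.IsIsostatic d := fun K =>
    ⟨fun ⟨K', h, h'⟩ => toSystem_injective h ▸ h', fun h => ⟨K, rfl, h⟩⟩
  constructor
  · rintro ⟨-, h2, h3, h4⟩
    exact ⟨h2, (hiso K).1 h3, fun K' h5 h6 h7 => toSystem_injective
      (h4 _ K'.valid_toSystem h5 h6 ((hiso K').2 h7))⟩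
  · rintro ⟨h2, h3, h4⟩
    refine ⟨K.valid_toSystem, h2, (hiso K).2 h3, fun K' _ h5 h6 h7 => ?_⟩
    obtain ⟨K', rfl, h8⟩ := h7
    rw [h4 K' h5 h6 h8]

theorem isComponent_toSystem_iff {G K : PinnedGraph V} :
    G.toSystem.IsComponent ends (SystemIso d) K.toSystem ↔ G.IsAssurComponent d K := by
  constructor
  · have key : ∀ G' K' : PinnedSystem V (Sym2 V), G'.IsComponent ends (SystemIso d) K' →
        ∀ G K : PinnedGraph V, G.toSystem = G' → K.toSystem = K' → G.IsAssurComponent d K := by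
      intro G' K' h
      induction h with
      | bottom h1 h2 =>
        rintro G K rfl rfl
        exact .bottom h1 (isMinimal_toSystem_iff.1 h2)
      | above h1 h2 _ ih =>
        rintro G K rfl rfl
        obtain ⟨A, rfl⟩ := exists_toSystem_eq h2.1 h1.2.2
        exact .above (A := A) h1 (isMinimal_toSystem_iff.1 h2) (ih _ _ rfl rfl)
    exact fun h => key _ _ h _ _ rfl rfl
  · intro h
    induction h with
    | bottom h1 h2 => exact .bottom h1 (isMinimal_toSystem_iff.2 h2)
    | above h1 h2 _ ih => exact .above (A := toSystem _) h1 (isMinimal_toSystem_iff.2 h2) ih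

open Classical in
/-- The entries of the rigidity matrix. -/
noncomputable def entry (p : V → EuclideanSpace ℝ (Fin d)) (e : Sym2 V) (v : V) (k : Fin d) : ℝ :=
  if h : v ∈ e then (p v - p (Sym2.Mem.other h)) k else 0

theorem entry_eq_zero (p : V → EuclideanSpace ℝ (Fin d)) (e : Sym2 V) (v : V) (h : v ∉ ends e) :
    entry p e v = 0 := by
  ext k
  exact dif_neg h

theorem isIsostaticAt_iff {K : PinnedGraph V} {p : V → EuclideanSpace ℝ (Fin d)} :
    K.IsIsostaticAt p ↔ K.toSystem.IsoAt (entry p) := Iff.rfl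

theorem IsIsostaticAt.sparse {G : PinnedGraph V} {p : V → EuclideanSpace ℝ (Fin d)}
    (h : G.IsIsostaticAt p) : G.toSystem.Sparse ends d :=
  PinnedSystem.IsoAt.sparse (entry_eq_zero p) G.valid_toSystem h

/-- The definition of an Assur graph allows a new realisation for each subgraph. This makes no
difference: any isostatic realisation gives the count, and the count makes `p` isostatic on the
subgraph. -/
theorem IsIsostaticAt.isAssurComponent_iff {G K : PinnedGraph V}
    {p : V → EuclideanSpace ℝ (Fin d)} (h : G.IsIsostaticAt p) :
    G.IsAssurComponent d K ↔ ∃ v ∈ G.inner, K.toSystem = G.toSystem.comp ends d v := by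
  rw [← isComponent_toSystem_iff]
  refine h.sparse.isComponent_iff G.valid_toSystem ?_
  refine PinnedSystem.IsoAt.counts (entry_eq_zero p) G.valid_toSystem h (fun K hK hKG hK' => ?_) ?_
  · obtain ⟨K, rfl⟩ := exists_toSystem_eq hK hKG
    exact ⟨K, rfl, p, hK'⟩
  · rintro _ ⟨K, rfl, q, hq⟩
    exact PinnedSystem.IsoAt.card_edges (isIsostaticAt_iff.1 hq)

end PinnedGraph

namespace PinnedGainGraph

variable {S W F : Type*} {Γ : GainGraph S W F} {d : ℕ}

/-- The underlying pinned system of a pinned gain graph. -/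
def toSystem (H : PinnedGainGraph Γ) : PinnedSystem W F := ⟨H.inner, H.pinned, H.edges⟩

theorem toSystem_injective : Function.Injective (toSystem (Γ := Γ)) := by
  rintro ⟨⟩ ⟨⟩ h
  simp only [toSystem, PinnedSystem.mk.injEq] at h
  obtain ⟨rfl, rfl, rfl⟩ := h
  rfl

/-- The ends of an edge of a gain graph. -/
def ends (Γ : GainGraph S W F) (f : F) : Set W := {w | w = Γ.src f ∨ w = Γ.tgt f}

theorem mem_ends {f : F} {w : W} : w ∈ ends Γ f ↔ w = Γ.src f ∨ w = Γ.tgt f := Iff.rfl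

theorem valid_toSystem (H : PinnedGainGraph Γ) : H.toSystem.Valid (ends Γ) where
  disjoint := H.disjoint
  mem_or_mem := by
    rintro f hf _ (rfl | rfl)
    exacts [H.src_mem f hf, H.tgt_mem f hf]

theorem toSystem_ground (H : PinnedGainGraph Γ) (A : Finset W) :
    (H.ground A).toSystem = H.toSystem.ground (ends Γ) A := by
  ext x
  · rfl
  · rfl
  · classical
    refine Finset.mem_filter.trans (Iff.trans ?_ Finset.mem_filter.symm)
    simp only [mem_ends, or_and_right, exists_or, exists_eq_left]
    rfl

theorem exists_toSystem_eq {K : PinnedSystem W F} (hK : K.Valid (ends Γ)) :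
    ∃ K' : PinnedGainGraph Γ, K'.toSystem = K :=
  ⟨⟨K.inner, K.pinned, K.edges, hK.disjoint, fun f hf => hK.mem_or_mem f hf _ (Or.inl rfl),
    fun f hf => hK.mem_or_mem f hf _ (Or.inr rfl)⟩, rfl⟩

variable [Group S] {τ : S →* (EuclideanSpace ℝ (Fin d) ≃ₗᵢ[ℝ] EuclideanSpace ℝ (Fin d))}

/-- The property of a pinned system to come from a pinned `S`-isostatic gain graph. -/
def SystemIso (Γ : GainGraph S W F)
    (τ : S →* (EuclideanSpace ℝ (Fin d) ≃ₗᵢ[ℝ] EuclideanSpace ℝ (Fin d)))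
    (K : PinnedSystem W F) : Prop :=
  ∃ K' : PinnedGainGraph Γ, K'.toSystem = K ∧ K'.IsIsostatic τ

theorem isMinimal_toSystem_iff {K : PinnedGainGraph Γ} :
    K.toSystem.IsMinimal (ends Γ) (SystemIso Γ τ) ↔ K.IsAssur τ := by
  have hiso : ∀ K : PinnedGainGraph Γ, SystemIso Γ τ K.toSystem ↔ K.IsIsostatic τ := fun K =>
    ⟨fun ⟨K', h, h'⟩ => toSystem_injective h ▸ h', fun h => ⟨K, rfl, h⟩⟩
  constructor
  · rintro ⟨-, h2, h3, h4⟩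
    exact ⟨h2, (hiso K).1 h3, fun K' h5 h6 h7 => toSystem_injective
      (h4 _ K'.valid_toSystem h5 h6 ((hiso K').2 h7))⟩
  · rintro ⟨h2, h3, h4⟩
    refine ⟨K.valid_toSystem, h2, (hiso K).2 h3, fun K' _ h5 h6 h7 => ?_⟩
    obtain ⟨K', rfl, h8⟩ := h7
    rw [h4 K' h5 h6 h8]

theorem isComponent_toSystem_iff {H K : PinnedGainGraph Γ} :
    H.toSystem.IsComponent (ends Γ) (SystemIso Γ τ) K.toSystem ↔ H.IsAssurComponent τ K := by
  constructor
  · have key : ∀ H' K' : PinnedSystem W F, H'.IsComponent (ends Γ) (SystemIso Γ τ) K' →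
        ∀ H K : PinnedGainGraph Γ, H.toSystem = H' → K.toSystem = K' →
          H.IsAssurComponent τ K := by
      intro H' K' h
      induction h with
      | bottom h1 h2 =>
        rintro H K rfl rfl
        exact .bottom h1 (isMinimal_toSystem_iff.1 h2)
      | above h1 h2 _ ih =>
        rintro H K rfl rfl
        obtain ⟨A, rfl⟩ := exists_toSystem_eq h2.1
        exact .above (A := A) h1 (isMinimal_toSystem_iff.1 h2)
          (ih _ _ (toSystem_ground _ _) rfl)
    exact fun h => key _ _ h _ _ rfl rfl
  · intro h
    induction h with
    | bottom h1 h2 => exact .bottom h1 (isMinimal_toSystem_iff.2 h2)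
    | above h1 h2 _ ih =>
      rw [toSystem_ground] at ih
      exact .above (A := toSystem _) h1 (isMinimal_toSystem_iff.2 h2) ih

open Classical in
/-- The entries of the pinned orbit matrix. -/
noncomputable def entry (Γ : GainGraph S W F)
    (τ : S →* (EuclideanSpace ℝ (Fin d) ≃ₗᵢ[ℝ] EuclideanSpace ℝ (Fin d)))
    (q : W → EuclideanSpace ℝ (Fin d)) (f : F) (w : W) (k : Fin d) : ℝ :=
  (if w = Γ.src f then (q (Γ.src f) - τ (Γ.gain f) (q (Γ.tgt f))) k else 0) +
    (if w = Γ.tgt f then (q (Γ.tgt f) - τ (Γ.gain f)⁻¹ (q (Γ.src f))) k else 0)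

theorem entry_eq_zero (q : W → EuclideanSpace ℝ (Fin d)) (f : F) (w : W) (h : w ∉ ends Γ f) :
    entry Γ τ q f w = 0 := by
  ext k
  simp only [mem_ends, not_or] at h
  simp [entry, h.1, h.2]

theorem isIsostaticAt_iff {K : PinnedGainGraph Γ} {q : W → EuclideanSpace ℝ (Fin d)} :
    K.IsIsostaticAt τ q ↔ K.toSystem.IsoAt (entry Γ τ q) := Iff.rfl

theorem IsIsostaticAt.sparse {H : PinnedGainGraph Γ} {q : W → EuclideanSpace ℝ (Fin d)}
    (h : H.IsIsostaticAt τ q) : H.toSystem.Sparse (ends Γ) d :=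
  PinnedSystem.IsoAt.sparse (entry_eq_zero q) H.valid_toSystem h

theorem IsIsostaticAt.isAssurComponent_iff {H K : PinnedGainGraph Γ}
    {q : W → EuclideanSpace ℝ (Fin d)} (h : H.IsIsostaticAt τ q) :
    H.IsAssurComponent τ K ↔
      ∃ w ∈ H.inner, K.toSystem = H.toSystem.comp (ends Γ) d w := by
  rw [← isComponent_toSystem_iff]
  refine h.sparse.isComponent_iff H.valid_toSystem ?_
  refine PinnedSystem.IsoAt.counts (entry_eq_zero q) H.valid_toSystem h (fun K hK _ hK' => ?_) ?_
  · obtain ⟨K, rfl⟩ := exists_toSystem_eq hK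
    exact ⟨K, rfl, q, hK'⟩
  · rintro _ ⟨K, rfl, q, hq⟩
    exact PinnedSystem.IsoAt.card_edges (isIsostaticAt_iff.1 hq)

end PinnedGainGraph

/-! ### The covering map -/

theorem vertexOrbit_eq_iff {S V : Type*} [Group S] [MulAction S V] {v w : V} :
    vertexOrbit S w = vertexOrbit S v ↔ ∃ x : S, x • v = w :=
  ⟨fun h => Quotient.exact h, fun ⟨x, h⟩ => Quotient.sound ⟨x, h⟩⟩

theorem edgeOrbit_eq_iff {S V : Type*} [Group S] [MulAction S V] {e e' : Sym2 V} :
    edgeOrbit S e = edgeOrbit S e' ↔ ∃ x : S, Sym2.map (x • ·) e = e' :=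
  ⟨fun h => Quotient.exact h, fun ⟨x, h⟩ => Quotient.sound ⟨x, h⟩⟩

/-- A finite set on which a finite group acts freely has as many elements as the group times the
number of orbits. -/
theorem card_eq_natCard_mul_of_free {S α β : Type*} [Finite S] (act : S → α → α) (π : α → β)
    (s : Finset α) (t : Finset β) (hst : ∀ a ∈ s, π a ∈ t) (hsurj : ∀ b ∈ t, ∃ a ∈ s, π a = b)
    (horb : ∀ a ∈ s, ∀ a', a' ∈ s ∧ π a' = π a ↔ ∃ x, act x a = a')
    (hinj : ∀ a ∈ s, Function.Injective (act · a)) : s.card = Nat.card S * t.card := by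
  classical
  have := Fintype.ofFinite S
  rw [Finset.card_eq_sum_card_fiberwise (f := π) (t := t) hst, mul_comm, ← smul_eq_mul,
    ← Finset.sum_const]
  refine Finset.sum_congr rfl fun b hb => ?_
  obtain ⟨a, ha, rfl⟩ := hsurj b hb
  rw [Nat.card_eq_fintype_card, ← Finset.card_univ, ← Finset.card_image_of_injective _ (hinj a ha)]
  congr 1
  ext a'
  simp [horb a ha a']

namespace PinnedGraph

variable {S V : Type*} [Group S] [MulAction S V] {d : ℕ} {G : PinnedGraph V}
  {hG : G.IsSymmetric S} {c : QuotientLabelling S V}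

theorem IsSymmetric.smul_mem_inner (hG : G.IsSymmetric S) (x : S) {v : V} :
    x • v ∈ G.inner ↔ v ∈ G.inner :=
  ⟨fun h => by simpa using hG.1 x⁻¹ _ h, hG.1 x v⟩

theorem IsSymmetric.smul_mem_pinned (hG : G.IsSymmetric S) (x : S) {v : V} :
    x • v ∈ G.pinned ↔ v ∈ G.pinned :=
  ⟨fun h => by simpa using hG.2.1 x⁻¹ _ h, hG.2.1 x v⟩

theorem map_inv_map_smul (x : S) (e : Sym2 V) :
    Sym2.map (x⁻¹ • ·) (Sym2.map (x • ·) e) = e := by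
  simp [Sym2.map_map]

theorem IsSymmetric.map_mem_edges (hG : G.IsSymmetric S) (x : S) {e : Sym2 V} :
    Sym2.map (x • ·) e ∈ G.edges ↔ e ∈ G.edges :=
  ⟨fun h => by simpa only [map_inv_map_smul] using hG.2.2 x⁻¹ _ h, hG.2.2 x e⟩

theorem vertexOrbit_mem_inner {v : V} :
    vertexOrbit S v ∈ (G.quotient hG c).toSystem.inner ↔ v ∈ G.inner := by
  classical
  refine ⟨fun h => ?_, fun h => Finset.mem_image_of_mem _ h⟩
  obtain ⟨w, hw, h⟩ := Finset.mem_image.1 h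
  obtain ⟨x, rfl⟩ := vertexOrbit_eq_iff.1 h
  exact (hG.smul_mem_inner x).1 hw

theorem vertexOrbit_mem_pinned {v : V} :
    vertexOrbit S v ∈ (G.quotient hG c).toSystem.pinned ↔ v ∈ G.pinned := by
  classical
  refine ⟨fun h => ?_, fun h => Finset.mem_image_of_mem _ h⟩
  obtain ⟨w, hw, h⟩ := Finset.mem_image.1 h
  obtain ⟨x, rfl⟩ := vertexOrbit_eq_iff.1 h
  exact (hG.smul_mem_pinned x).1 hw

theorem edgeOrbit_mem_edges {e : Sym2 V} :
    edgeOrbit S e ∈ (G.quotient hG c).toSystem.edges ↔ e ∈ G.edges := by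
  classical
  refine ⟨fun h => ?_, fun h => Finset.mem_image_of_mem _ h⟩
  obtain ⟨e', he', h⟩ := Finset.mem_image.1 h
  obtain ⟨x, rfl⟩ := edgeOrbit_eq_iff.1 h
  exact (hG.map_mem_edges x).2 he'

theorem mem_ends_edgeOrbit {e : Sym2 V} {o : VertexOrbits S V} :
    o ∈ PinnedGainGraph.ends c.toGainGraph (edgeOrbit S e) ↔ ∃ v ∈ e, vertexOrbit S v = o := by
  have h := c.edgeOrbit_rep (edgeOrbit S e)
  constructor
  · rintro (rfl | rfl)
    · obtain ⟨w, hw, h'⟩ := exists_mem_of_edgeOrbit_eq h.symm (Sym2.mem_mk_left _ _)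
      exact ⟨w, hw, h'.trans (c.vertexOrbit_rep _)⟩
    · obtain ⟨w, hw, h'⟩ := exists_mem_of_edgeOrbit_eq h.symm (Sym2.mem_mk_right _ _)
      exact ⟨w, hw, by rw [h', vertexOrbit_smul, c.vertexOrbit_rep]⟩
  · rintro ⟨v, hv, rfl⟩
    obtain ⟨w, hw, h'⟩ := exists_mem_of_edgeOrbit_eq h hv
    rcases Sym2.mem_iff.1 hw with rfl | rfl
    · left
      rw [← h', c.vertexOrbit_rep]
    · right
      rw [← h', vertexOrbit_smul, c.vertexOrbit_rep]

open Classical in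
/-- The inner vertices over a set of vertex orbits. -/
noncomputable def cover (G : PinnedGraph V) (X : Finset (VertexOrbits S V)) : Finset V :=
  G.inner.filter fun v => vertexOrbit S v ∈ X

theorem mem_cover {X : Finset (VertexOrbits S V)} {v : V} :
    v ∈ G.cover X ↔ v ∈ G.inner ∧ vertexOrbit S v ∈ X := by
  simp [cover]

theorem edgeOrbit_mem_ind {X : Finset (VertexOrbits S V)} {e : Sym2 V} :
    edgeOrbit S e ∈ (G.quotient hG c).toSystem.ind (PinnedGainGraph.ends c.toGainGraph) X ↔
      e ∈ G.toSystem.ind ends (G.cover X) := by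
  simp only [PinnedSystem.mem_ind, edgeOrbit_mem_edges, mem_ends_edgeOrbit, mem_cover, mem_ends]
  refine and_congr_right fun _ => ⟨fun h v hv hv' => ⟨hv', h _ ⟨v, hv, rfl⟩ ?_⟩, ?_⟩
  · exact vertexOrbit_mem_inner.2 hv'
  · rintro h _ ⟨v, hv, rfl⟩ hv'
    exact (h v hv (vertexOrbit_mem_inner.1 hv')).2

/-- Each vertex orbit in `X` and each edge orbit induced by `X` has exactly `|S|` elements, so the
two counts differ by a common factor. Freeness on edges excludes edges that a group element
reverses, whose orbits would be smaller. -/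
theorem tight_cover_iff [Finite S] (hfreeV : G.IsFreeOnVertices S) (hfreeE : G.IsFreeOnEdges S)
    {X : Finset (VertexOrbits S V)} (hX : X ⊆ (G.quotient hG c).toSystem.inner) :
    G.toSystem.Tight ends d (G.cover X) ↔
      (G.quotient hG c).toSystem.Tight (PinnedGainGraph.ends c.toGainGraph) d X := by
  classical
  have h1 : (G.cover X).card = Nat.card S * X.card := by
    refine card_eq_natCard_mul_of_free (fun x v => x • v) (vertexOrbit S) _ _
      (fun v hv => (mem_cover.1 hv).2) (fun o ho => ?_) (fun v hv w => ?_) (fun v hv x y hxy => ?_)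
    · obtain ⟨v, hv, rfl⟩ := Finset.mem_image.1 (hX ho)
      exact ⟨v, mem_cover.2 ⟨hv, ho⟩, rfl⟩
    · rw [mem_cover] at hv
      rw [← vertexOrbit_eq_iff, mem_cover]
      refine and_iff_right_of_imp fun h => ⟨?_, h ▸ hv.2⟩
      rw [← vertexOrbit_mem_inner (hG := hG) (c := c), h]
      exact hX hv.2
    · have := hfreeV v (Or.inl (mem_cover.1 hv).1) (y⁻¹ * x)
        (by rw [mul_smul, inv_smul_eq_iff]; exact hxy)
      rwa [inv_mul_eq_one, eq_comm] at this
  have h2 : (G.toSystem.ind ends (G.cover X)).card = Nat.card S *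
      ((G.quotient hG c).toSystem.ind (PinnedGainGraph.ends c.toGainGraph) X).card := by
    refine card_eq_natCard_mul_of_free (fun x e => Sym2.map (x • ·) e) (edgeOrbit S) _ _
      (fun e he => edgeOrbit_mem_ind.2 he) (fun f hf => ?_) (fun e he e' => ?_)
      (fun e he x y hxy => ?_)
    · obtain ⟨e, he, rfl⟩ := Finset.mem_image.1 (PinnedSystem.mem_ind.1 hf).1
      exact ⟨e, edgeOrbit_mem_ind.1 hf, rfl⟩
    · rw [← edgeOrbit_eq_iff, eq_comm (a := edgeOrbit S e')]
      refine and_iff_right_of_imp fun h => ?_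
      rw [← edgeOrbit_mem_ind (hG := hG) (c := c)] at he ⊢
      rwa [← h]
    · have := hfreeE e (PinnedSystem.mem_ind.1 he).1 (y⁻¹ * x) (by
        have h := congrArg (Sym2.map (y⁻¹ • ·)) hxy
        simp only [map_inv_map_smul] at h
        rw [Sym2.map_map] at h
        simp only [mul_smul]
        exact h)
      rwa [inv_mul_eq_one, eq_comm] at this
  have h3 : G.cover X ⊆ G.inner := fun v hv => (mem_cover.1 hv).1
  have h4 : 0 < Nat.card S := Nat.card_pos
  unfold PinnedSystem.Tight
  rw [h1, h2, mul_left_comm, Nat.mul_right_inj h4.ne']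
  exact ⟨fun h => ⟨hX, h.2⟩, fun h => ⟨h3, h.2⟩⟩

/-! ### Translates of closures and classes -/

open Classical in
theorem IsSymmetric.tight_image (hG : G.IsSymmetric S) (x : S) {X : Finset V}
    (hX : G.toSystem.Tight ends d X) : G.toSystem.Tight ends d (X.image (x • ·)) := by
  refine ⟨fun w hw => ?_, ?_⟩
  · obtain ⟨v, hv, rfl⟩ := Finset.mem_image.1 hw
    exact (hG.smul_mem_inner x).2 (hX.1 hv)
  · rw [Finset.card_image_of_injective _ (MulAction.injective x), ← hX.2]
    symm
    refine Finset.card_bij (fun e _ => Sym2.map (x • ·) e) (fun e he => ?_) (fun e _ e' _ h => ?_)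
      (fun e he => ⟨Sym2.map (x⁻¹ • ·) e, ?_, ?_⟩)
    · rw [PinnedSystem.mem_ind] at he ⊢
      refine ⟨(hG.map_mem_edges x).2 he.1, fun w hw hw' => ?_⟩
      obtain ⟨v, hv, rfl⟩ := Sym2.mem_map.1 hw
      exact Finset.mem_image_of_mem _ (he.2 v hv ((hG.smul_mem_inner x).1 hw'))
    · exact Sym2.map.injective (MulAction.injective x) h
    · rw [PinnedSystem.mem_ind] at he ⊢
      refine ⟨(hG.map_mem_edges x⁻¹).2 he.1, fun w hw hw' => ?_⟩
      obtain ⟨v, hv, rfl⟩ := Sym2.mem_map.1 hw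
      obtain ⟨u, hu, rfl⟩ := Finset.mem_image.1 (he.2 v hv ((hG.smul_mem_inner x⁻¹).1 hw'))
      simpa using hu
    · simpa only [inv_inv] using map_inv_map_smul x⁻¹ e

theorem IsSymmetric.smul_mem_tightClosure (hG : G.IsSymmetric S) (x : S) {v w : V} :
    x • w ∈ G.toSystem.tightClosure ends d (x • v) ↔ w ∈ G.toSystem.tightClosure ends d v := by
  classical
  have key : ∀ (x : S) {v w : V}, w ∈ G.toSystem.tightClosure ends d v →
      x • w ∈ G.toSystem.tightClosure ends d (x • v) := by
    intro x v w hw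
    simp only [PinnedSystem.tightClosure, Finset.mem_filter] at hw ⊢
    refine ⟨(hG.smul_mem_inner x).2 hw.1, fun X hX hv => ?_⟩
    obtain ⟨u, hu, hu'⟩ := Finset.mem_image.1 (hw.2 _ (hG.tight_image x⁻¹ hX)
      (Finset.mem_image.2 ⟨_, hv, inv_smul_smul x v⟩))
    rw [← hu']
    simpa using hu
  exact ⟨fun h => by simpa using key x⁻¹ h, key x⟩

theorem IsSymmetric.card_tightClosure_smul (hG : G.IsSymmetric S) (x : S) (v : V) :
    (G.toSystem.tightClosure ends d (x • v)).card = (G.toSystem.tightClosure ends d v).card := by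
  refine (Finset.card_bij (fun w _ => x • w) (fun w hw => (hG.smul_mem_tightClosure x).2 hw)
    (fun _ _ _ _ h => MulAction.injective x h) fun w hw => ⟨x⁻¹ • w, ?_, by simp⟩).symm
  rw [← hG.smul_mem_tightClosure x]
  simpa using hw

/-- The closure of `w` is contained in that of `v` and, by `hc`, has the size of a translate of it.
A class is thus never strictly below one of its translates. -/
theorem IsSymmetric.tightClosure_eq_of_mem (hG : G.IsSymmetric S) (h : G.toSystem.Sparse ends d)
    {x : S} {v w : V} (hw : w ∈ G.toSystem.tightClosure ends d v)
    (hc : G.toSystem.tightClosure ends d w = G.toSystem.tightClosure ends d (x • v)) :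
    G.toSystem.tightClosure ends d w = G.toSystem.tightClosure ends d v :=
  Finset.eq_of_subset_of_card_le (h.tightClosure_mono hw)
    (by rw [hc, hG.card_tightClosure_smul])

/-- Equivalence means mutual membership in closures, and this is invariant under the group. -/
theorem IsSymmetric.smul_mem_tightClass (hG : G.IsSymmetric S) (h : G.toSystem.Sparse ends d)
    (x : S) {v w : V} (hv : v ∈ G.inner) :
    x • w ∈ G.toSystem.tightClass ends d (x • v) ↔ w ∈ G.toSystem.tightClass ends d v := by
  have key : ∀ {v w : V}, v ∈ G.inner → (w ∈ G.toSystem.tightClass ends d v ↔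
      w ∈ G.toSystem.tightClosure ends d v ∧ v ∈ G.toSystem.tightClosure ends d w) := by
    intro v w hv
    refine ⟨fun hw => ⟨PinnedSystem.tightClass_subset _ hw, ?_⟩, fun ⟨h1, h2⟩ => ?_⟩
    · rw [(PinnedSystem.mem_tightClass.1 hw).2]
      exact PinnedSystem.mem_tightClosure_self hv
    · exact PinnedSystem.mem_tightClass.2 ⟨PinnedSystem.tightClosure_subset_inner _ h1,
        (h.tightClosure_mono h1).antisymm (h.tightClosure_mono h2)⟩
  rw [key hv, key ((hG.smul_mem_inner x).2 hv), hG.smul_mem_tightClosure,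
    hG.smul_mem_tightClosure]

/-! ### Closures, classes and components in the quotient -/

/-- The group acts freely on `G`, and `G` and its quotient are sparse. -/
structure IsSparseCovering (d : ℕ) (hG : G.IsSymmetric S) (c : QuotientLabelling S V) : Prop where
  freeV : G.IsFreeOnVertices S
  freeE : G.IsFreeOnEdges S
  sparse : G.toSystem.Sparse ends d
  sparse_quotient : (G.quotient hG c).toSystem.Sparse (PinnedGainGraph.ends c.toGainGraph) d

namespace IsSparseCovering

variable {v w : V} {e : Sym2 V}

/-- The union of the closures of all translates of `v` is tight and invariant, so it is the preimage
of a tight set of orbits that contains the orbit of `v`. Conversely, the preimage of the closure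
downstairs is tight and contains every translate. -/
theorem vertexOrbit_mem_tightClosure [Finite S] (h : IsSparseCovering d hG c)
    (hv : v ∈ G.inner) :
    vertexOrbit S w ∈ (G.quotient hG c).toSystem.tightClosure
      (PinnedGainGraph.ends c.toGainGraph) d (vertexOrbit S v) ↔
      ∃ x : S, w ∈ G.toSystem.tightClosure ends d (x • v) := by
  classical
  have := Fintype.ofFinite S
  constructor
  · intro hw
    set Z := Finset.univ.biUnion fun x : S => G.toSystem.tightClosure ends d (x • v) with hZ
    have hZt : G.toSystem.Tight ends d Z :=
      (h.sparse.biUnion _ _ fun x _ => h.sparse.tight_tightClosure _).1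
    have hZc : G.cover (Z.image (vertexOrbit S)) = Z := by
      ext u
      rw [mem_cover]
      constructor
      · rintro ⟨-, hu⟩
        obtain ⟨u', hu', hu⟩ := Finset.mem_image.1 hu
        obtain ⟨y, rfl⟩ := vertexOrbit_eq_iff.1 hu
        obtain ⟨x, -, hx⟩ := Finset.mem_biUnion.1 hu'
        refine Finset.mem_biUnion.2 ⟨y⁻¹ * x, Finset.mem_univ _, ?_⟩
        rw [← hG.smul_mem_tightClosure y]
        simpa [mul_smul] using hx
      · exact fun hu => ⟨hZt.1 hu, Finset.mem_image_of_mem _ hu⟩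
    have hZs : Z.image (vertexOrbit S) ⊆ (G.quotient hG c).toSystem.inner :=
      Finset.image_subset_image hZt.1
    have h1 := (tight_cover_iff (d := d) h.freeV h.freeE hZs).1 (hZc.symm ▸ hZt)
    have h2 : v ∈ Z := Finset.mem_biUnion.2 ⟨1, Finset.mem_univ _, by
      rw [one_smul]; exact PinnedSystem.mem_tightClosure_self hv⟩
    have h3 := h1.tightClosure_subset (Finset.mem_image_of_mem _ h2) hw
    have h4 : w ∈ G.cover (Z.image (vertexOrbit S)) :=
      mem_cover.2 ⟨vertexOrbit_mem_inner.1 (hZs h3), h3⟩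
    rw [hZc] at h4
    obtain ⟨x, -, hx⟩ := Finset.mem_biUnion.1 h4
    exact ⟨x, hx⟩
  · rintro ⟨x, hx⟩
    have h1 := h.sparse_quotient.tight_tightClosure (vertexOrbit S v)
    have h2 := ((tight_cover_iff h.freeV h.freeE h1.1).2 h1).tightClosure_subset
      (v := x • v) (mem_cover.2 ⟨(hG.smul_mem_inner x).2 hv, ?_⟩) hx
    · exact (mem_cover.1 h2).2
    · rw [vertexOrbit_smul]
      exact PinnedSystem.mem_tightClosure_self (vertexOrbit_mem_inner.2 hv)

/-- Equivalence of orbits only gives that `w` is below some `x • v` and `v` below some `y • w`.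
Since translates have closures of equal size, the closures of `w` and `x • v` coincide. -/
theorem vertexOrbit_mem_tightClass [Finite S] (h : IsSparseCovering d hG c)
    (hv : v ∈ G.inner) :
    vertexOrbit S w ∈ (G.quotient hG c).toSystem.tightClass
      (PinnedGainGraph.ends c.toGainGraph) d (vertexOrbit S v) ↔
      ∃ x : S, w ∈ G.toSystem.tightClass ends d (x • v) := by
  constructor
  · intro hw
    obtain ⟨hwi, hwc⟩ := PinnedSystem.mem_tightClass.1 hw
    have hwi' := vertexOrbit_mem_inner.1 hwi
    obtain ⟨x, hx⟩ := (h.vertexOrbit_mem_tightClosure hv).1 (PinnedSystem.tightClass_subset _ hw)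
    obtain ⟨y, hy⟩ := (h.vertexOrbit_mem_tightClosure (v := w) (w := v) hwi').1 (by
      rw [hwc]
      exact PinnedSystem.mem_tightClosure_self (vertexOrbit_mem_inner.2 hv))
    refine ⟨x, PinnedSystem.mem_tightClass.2 ⟨hwi', ?_⟩⟩
    refine Finset.eq_of_subset_of_card_le (h.sparse.tightClosure_mono hx) ?_
    rw [hG.card_tightClosure_smul, ← hG.card_tightClosure_smul y w]
    exact Finset.card_le_card (h.sparse.tightClosure_mono hy)
  · rintro ⟨x, hx⟩
    obtain ⟨hwi, hwc⟩ := PinnedSystem.mem_tightClass.1 hx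
    have h1 := (h.vertexOrbit_mem_tightClosure hv).2 ⟨x, PinnedSystem.tightClass_subset _ hx⟩
    have h2 := (h.vertexOrbit_mem_tightClosure (v := w) (w := v) hwi).2 ⟨x⁻¹, by
      rw [← hG.smul_mem_tightClosure x, smul_inv_smul, hwc]
      exact PinnedSystem.mem_tightClosure_self ((hG.smul_mem_inner x).2 hv)⟩
    exact PinnedSystem.mem_tightClass.2 ⟨vertexOrbit_mem_inner.2 hwi,
      (h.sparse_quotient.tightClosure_mono h1).antisymm (h.sparse_quotient.tightClosure_mono h2)⟩

theorem edgeOrbit_mem_comp_edges [Finite S] (h : IsSparseCovering d hG c)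
    (hv : v ∈ G.inner) :
    edgeOrbit S e ∈ ((G.quotient hG c).toSystem.comp
      (PinnedGainGraph.ends c.toGainGraph) d (vertexOrbit S v)).edges ↔
      ∃ x : S, e ∈ (G.toSystem.comp ends d (x • v)).edges := by
  simp only [PinnedSystem.mem_comp_edges, edgeOrbit_mem_ind, mem_ends_edgeOrbit]
  constructor
  · rintro ⟨h1, _, ⟨a, ha, rfl⟩, h2⟩
    obtain ⟨x, hx⟩ := (h.vertexOrbit_mem_tightClass hv).1 h2
    obtain ⟨he, h1⟩ := PinnedSystem.mem_ind.1 h1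
    -- A priori the ends of `e` may lie in the closures of different translates. One end `b` has a
    -- closure that induces `e`, hence contains `a`; as `b` is below some `y • v`, comparing sizes
    -- identifies the closures of `a` and `b`.
    obtain ⟨b, hb, hbi, heb⟩ := h.sparse.exists_mem_ind_tightClosure he
    obtain ⟨y, hy⟩ := (h.vertexOrbit_mem_tightClosure hv).1 (mem_cover.1 (h1 b hb hbi)).2
    obtain ⟨hai, hac⟩ := PinnedSystem.mem_tightClass.1 hx
    have hab : a ∈ G.toSystem.tightClosure ends d b := (PinnedSystem.mem_ind.1 heb).2 a ha hai
    have hab' : G.toSystem.tightClosure ends d a = G.toSystem.tightClosure ends d b := by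
      refine Finset.eq_of_subset_of_card_le (h.sparse.tightClosure_mono hab) ?_
      rw [hac, hG.card_tightClosure_smul, ← hG.card_tightClosure_smul y v]
      exact Finset.card_le_card (h.sparse.tightClosure_mono hy)
    refine ⟨x, ?_, a, ha, hx⟩
    rwa [← hac, hab']
  · rintro ⟨x, h1, a, ha, hx⟩
    refine ⟨?_, _, ⟨a, ha, rfl⟩, (h.vertexOrbit_mem_tightClass hv).2 ⟨x, hx⟩⟩
    refine PinnedSystem.ind_mono (fun w hw => mem_cover.2
      ⟨PinnedSystem.tightClosure_subset_inner _ hw, ?_⟩) h1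
    exact (h.vertexOrbit_mem_tightClosure hv).2 ⟨x, hw⟩

theorem vertexOrbit_mem_comp_pinned [Finite S] (h : IsSparseCovering d hG c)
    (hv : v ∈ G.inner) :
    vertexOrbit S w ∈ ((G.quotient hG c).toSystem.comp
      (PinnedGainGraph.ends c.toGainGraph) d (vertexOrbit S v)).pinned ↔
      ∃ x : S, w ∈ (G.toSystem.comp ends d (x • v)).pinned := by
  rw [PinnedSystem.mem_comp_pinned, vertexOrbit_mem_inner, vertexOrbit_mem_pinned,
    h.vertexOrbit_mem_tightClass hv]
  constructor
  · rintro ⟨h1, h2, f, hf, hwf⟩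
    obtain ⟨e, rfl⟩ : ∃ e, edgeOrbit S e = f := Quotient.exists_rep f
    obtain ⟨u, hu, huw⟩ := mem_ends_edgeOrbit.1 hwf
    obtain ⟨y, rfl⟩ := vertexOrbit_eq_iff.1 huw
    -- The edge is moved within its orbit so that `w` itself becomes an end.
    have hfe : edgeOrbit S (Sym2.map (y⁻¹ • ·) e) = edgeOrbit S e :=
      (edgeOrbit_eq_iff.2 ⟨y⁻¹, rfl⟩).symm
    rw [← hfe] at hf
    obtain ⟨x, hx⟩ := (h.edgeOrbit_mem_comp_edges hv).1 hf
    exact ⟨x, PinnedSystem.mem_comp_pinned.2 ⟨h1, fun h3 => h2 ⟨x, h3⟩, _, hx,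
      Sym2.mem_map.2 ⟨_, hu, inv_smul_smul y w⟩⟩⟩
  · rintro ⟨x, hx⟩
    obtain ⟨h1, h2, e, he, hwe⟩ := PinnedSystem.mem_comp_pinned.1 hx
    refine ⟨h1, ?_, edgeOrbit S e, (h.edgeOrbit_mem_comp_edges hv).2 ⟨x, he⟩,
      mem_ends_edgeOrbit.2 ⟨w, hwe, rfl⟩⟩
    rintro ⟨y, hy⟩
    obtain ⟨hwi, hwc⟩ := PinnedSystem.mem_tightClass.1 hy
    have hwx := (PinnedSystem.mem_ind.1 (PinnedSystem.mem_comp_edges.1 he).1).2 w hwe hwi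
    -- If `w` were in the class of another translate `y • v`, then, lying below `x • v`, it would
    -- already be in the class of `x • v`. The element `y * x⁻¹` carries `x • v` to `y • v`.
    refine h2 (PinnedSystem.mem_tightClass.2 ⟨hwi, ?_⟩)
    refine hG.tightClosure_eq_of_mem h.sparse (x := y * x⁻¹) hwx ?_
    rw [hwc, mul_smul, inv_smul_smul]

theorem map_mem_comp_edges (h : IsSparseCovering d hG c) (x : S) (hv : v ∈ G.inner) :
    Sym2.map (x • ·) e ∈ (G.toSystem.comp ends d (x • v)).edges ↔
      e ∈ (G.toSystem.comp ends d v).edges := by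
  have hm : ∀ p : V → Prop, (∀ w ∈ ends (Sym2.map (x • ·) e), p w) ↔ ∀ w ∈ ends e, p (x • w) :=
    fun p => by simp [mem_ends, Sym2.mem_map]
  have hm' : ∀ p : V → Prop, (∃ w ∈ ends (Sym2.map (x • ·) e), p w) ↔ ∃ w ∈ ends e, p (x • w) :=
    fun p => by simp [mem_ends, Sym2.mem_map]
  simp only [PinnedSystem.mem_comp_edges, PinnedSystem.mem_ind, hm, hm',
    hG.smul_mem_tightClosure, hG.smul_mem_tightClass h.sparse x hv]
  exact and_congr_left fun _ => and_congr (hG.map_mem_edges x)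
    (forall₂_congr fun w _ => imp_congr_left (hG.smul_mem_inner x))

theorem smul_mem_comp_pinned (h : IsSparseCovering d hG c) (x : S) (hv : v ∈ G.inner)
    (hw : w ∈ (G.toSystem.comp ends d v).pinned) :
    x • w ∈ (G.toSystem.comp ends d (x • v)).pinned := by
  rw [PinnedSystem.mem_comp_pinned] at hw ⊢
  obtain ⟨h1, h2, e, he, hwe⟩ := hw
  refine ⟨h1.imp (hG.smul_mem_inner x).2 (hG.smul_mem_pinned x).2, ?_, Sym2.map (x • ·) e,
    (h.map_mem_comp_edges x hv).2 he, Sym2.mem_map.2 ⟨w, hwe, rfl⟩⟩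
  rwa [hG.smul_mem_tightClass h.sparse x hv]

end IsSparseCovering

/-- The orbit map of `v` embeds the group in the finite set of inner vertices. -/
theorem IsFreeOnVertices.finite (hfreeV : G.IsFreeOnVertices S) (hG : G.IsSymmetric S) {v : V}
    (hv : v ∈ G.inner) : Finite S := by
  refine Finite.of_injective (fun x : S => (⟨x • v, hG.1 x v hv⟩ : G.inner)) fun x y hxy => ?_
  have := hfreeV v (Or.inl hv) (y⁻¹ * x)
    (by rw [mul_smul, inv_smul_eq_iff]; exact congrArg Subtype.val hxy)
  rwa [inv_mul_eq_one, eq_comm] at this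

/-- A pinned `S`-isostatic symmetric realisation is pinned `S`-regular. -/
theorem isSRegularAt_of_isIsostaticAt
    {τ : S →* (EuclideanSpace ℝ (Fin d) ≃ₗᵢ[ℝ] EuclideanSpace ℝ (Fin d))}
    {p : V → EuclideanSpace ℝ (Fin d)} (hp : G.IsSymmetricAt τ p)
    (h : (G.quotient hG c).IsIsostaticAt τ fun o => p (c.rep o)) : G.IsSRegularAt τ hG c p := by
  refine ⟨hp, fun q _ => (Matrix.rank_le_card_height _).trans ?_⟩
  exact (LinearIndependent.rank_matrix h.2).ge

end PinnedGraph

/-! ### Projections and lifts of the components -/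

theorem mainTheorem2 {S V : Type*} [Group S] [MulAction S V] {d : ℕ}
    (τ : S →* (EuclideanSpace ℝ (Fin d) ≃ₗᵢ[ℝ] EuclideanSpace ℝ (Fin d)))
    (G : PinnedGraph V) (hG : G.IsSymmetric S) (c : QuotientLabelling S V)
    (hfreeV : G.IsFreeOnVertices S) (hfreeE : G.IsFreeOnEdges S)
    (hS : G.IsSIsostatic τ hG c)
    (hreg : ∀ p : V → EuclideanSpace ℝ (Fin d),
      G.IsSRegularAt τ hG c p → G.IsIsostaticAt p) :
    (∀ K : PinnedGraph V, G.IsAssurComponent d K →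
      ∃ L : PinnedGainGraph c.toGainGraph,
        K.ProjectsTo L ∧ (G.quotient hG c).IsAssurComponent τ L) ∧
    (∀ L : PinnedGainGraph c.toGainGraph, (G.quotient hG c).IsAssurComponent τ L →
      ∃ 𝒦 : Set (PinnedGraph V),
        (∀ K ∈ 𝒦, G.IsAssurComponent d K) ∧
        𝒦.PairwiseDisjoint PinnedGraph.inner ∧ L.LiftsTo 𝒦) := by
  obtain ⟨p, hp, hq⟩ := hS
  have hiso := hreg p (PinnedGraph.isSRegularAt_of_isIsostaticAt hp hq)
  have h : PinnedGraph.IsSparseCovering d hG c := ⟨hfreeV, hfreeE, hiso.sparse, hq.sparse⟩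
  constructor
  · intro K hK
    obtain ⟨v, hv, hKv⟩ := hiso.isAssurComponent_iff.1 hK
    have := hfreeV.finite hG hv
    obtain ⟨L, hL⟩ := PinnedGainGraph.exists_toSystem_eq (PinnedSystem.valid_comp (d := d)
      (G.quotient hG c).valid_toSystem (vertexOrbit S v))
    refine ⟨L, ?_, hq.isAssurComponent_iff.2 ⟨_,
      (PinnedGraph.vertexOrbit_mem_inner (hG := hG) (c := c)).2 hv, hL⟩⟩
    refine ⟨?_, ?_, ?_⟩
    · change (L.toSystem.inner : Set _) = vertexOrbit S '' (K.toSystem.inner : Set V)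
      rw [hL, hKv]
      ext o
      obtain ⟨w, rfl⟩ : ∃ w, vertexOrbit S w = o := Quotient.exists_rep o
      -- The classes of all `x • v` are translates of the class of `v`, so this one class already
      -- meets every orbit involved. Pinned vertices and edges are treated in the same way.
      refine (h.vertexOrbit_mem_tightClass hv).trans ⟨fun ⟨x, hx⟩ => ⟨x⁻¹ • w, ?_, ?_⟩, ?_⟩
      · refine (hG.smul_mem_tightClass h.sparse x hv).1 ?_
        rwa [smul_inv_smul]
      · exact PinnedGraph.vertexOrbit_smul _ _
      · rintro ⟨u, hu, huw⟩
        obtain ⟨x, rfl⟩ := vertexOrbit_eq_iff.1 huw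
        refine ⟨x⁻¹, (hG.smul_mem_tightClass h.sparse x ((hG.smul_mem_inner _).2 hv)).1 ?_⟩
        rwa [smul_inv_smul]
    · change (L.toSystem.pinned : Set _) = vertexOrbit S '' (K.toSystem.pinned : Set V)
      rw [hL, hKv]
      ext o
      obtain ⟨w, rfl⟩ : ∃ w, vertexOrbit S w = o := Quotient.exists_rep o
      refine (h.vertexOrbit_mem_comp_pinned hv).trans ⟨fun ⟨x, hx⟩ => ⟨x⁻¹ • w, ?_, ?_⟩, ?_⟩
      · have := h.smul_mem_comp_pinned x⁻¹ ((hG.smul_mem_inner x).2 hv) hx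
        rwa [inv_smul_smul] at this
      · exact PinnedGraph.vertexOrbit_smul _ _
      · rintro ⟨u, hu, huw⟩
        obtain ⟨x, rfl⟩ := vertexOrbit_eq_iff.1 huw
        have := h.smul_mem_comp_pinned x⁻¹ hv hu
        rw [inv_smul_smul] at this
        exact ⟨x⁻¹, this⟩
    · change (L.toSystem.edges : Set _) = edgeOrbit S '' (K.toSystem.edges : Set (Sym2 V))
      rw [hL, hKv]
      ext f
      obtain ⟨e, rfl⟩ : ∃ e, edgeOrbit S e = f := Quotient.exists_rep f
      refine (h.edgeOrbit_mem_comp_edges hv).trans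
        ⟨fun ⟨x, hx⟩ => ⟨Sym2.map (x⁻¹ • ·) e, ?_, ?_⟩, ?_⟩
      · have := (h.map_mem_comp_edges x⁻¹ ((hG.smul_mem_inner x).2 hv)).2 hx
        rwa [inv_smul_smul] at this
      · exact (edgeOrbit_eq_iff.2 ⟨x⁻¹, rfl⟩).symm
      · rintro ⟨e', he', hee⟩
        obtain ⟨x, rfl⟩ := edgeOrbit_eq_iff.1 hee
        exact ⟨x, (h.map_mem_comp_edges x hv).2 he'⟩
  · intro L hL
    obtain ⟨o, ho, hLo⟩ := hq.isAssurComponent_iff.1 hL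
    obtain ⟨v, rfl⟩ : ∃ v, vertexOrbit S v = o := Quotient.exists_rep o
    have hv := (PinnedGraph.vertexOrbit_mem_inner (hG := hG) (c := c)).1 ho
    have := hfreeV.finite hG hv
    have hex : ∀ x : S, ∃ K : PinnedGraph V,
        K.toSystem = G.toSystem.comp PinnedGraph.ends d (x • v) := fun x =>
      PinnedGraph.exists_toSystem_eq (PinnedSystem.valid_comp G.valid_toSystem _)
        (PinnedSystem.comp_edges_subset _)
    choose K hK using hex
    -- The family consists of the components of the translates of `v`. Different `x` may give the
    -- same component, hence a set; two members that share an inner vertex have the same closure and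
    -- so are equal.
    refine ⟨Set.range K, ?_, ?_, ?_, ?_, ?_⟩
    · rintro _ ⟨x, rfl⟩
      exact hiso.isAssurComponent_iff.2 ⟨x • v, hG.1 x v hv, hK x⟩
    · rintro _ ⟨x, rfl⟩ _ ⟨y, rfl⟩ hne
      refine Finset.disjoint_left.2 fun w hwx hwy => hne (PinnedGraph.toSystem_injective ?_)
      change w ∈ (K x).toSystem.inner at hwx
      change w ∈ (K y).toSystem.inner at hwy
      rw [hK] at hwx hwy ⊢
      rw [hK]
      exact PinnedSystem.comp_congr ((PinnedSystem.mem_tightClass.1 hwx).2.symm.trans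
        (PinnedSystem.mem_tightClass.1 hwy).2)
    · ext w
      simp only [Set.mem_iUnion, Set.exists_range_iff, exists_prop]
      change vertexOrbit S w ∈ L.toSystem.inner ↔ ∃ x, w ∈ (K x).toSystem.inner
      simp only [hLo, hK]
      exact h.vertexOrbit_mem_tightClass hv
    · ext w
      simp only [Set.mem_iUnion, Set.exists_range_iff, exists_prop]
      change vertexOrbit S w ∈ L.toSystem.pinned ↔ ∃ x, w ∈ (K x).toSystem.pinned
      simp only [hLo, hK]
      exact h.vertexOrbit_mem_comp_pinned hv
    · ext e
      simp only [Set.mem_iUnion, Set.exists_range_iff, exists_prop]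
      change edgeOrbit S e ∈ L.toSystem.edges ↔ ∃ x, e ∈ (K x).toSystem.edges
      simp only [hLo, hK]
      exact h.edgeOrbit_mem_comp_edges hv
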